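/- Let $m>2$ be an integer and $0<2\alpha<1$. For $x,\xi\in\mathbb R^m$ put $$r^2=\sum_{i=1}^m(x_i-\xi_i)^2,\qquad r_1^2=(x_1+\xi_1)^2+\sum_{i=2}^m(x_i-\xi_i)^2,\qquad \zeta=1-\frac{r_1^2}{r^2},$$ $$q_1(x,\xi)=k_1\,(r^2)^{-\alpha-\frac{m-2}{2}}\,F\!\left(\alpha+\tfrac{m-2}{2},\alpha;2\alpha;\zeta\right),\qquad k_1=\frac{\Gamma(\alpha)\,\Gamma\!\left(\alpha+\frac{m-2}{2}\right)}{4^{1-\alpha}\pi^{m/2}\,\Gamma(2\alpha)},$$ where $F$ is the Gauss hypergeometric function (analytically continued to $(-\infty,1)$). Let $\Omega$ be a bounded domain in the half-space $\{x_1>0\}$ whose boundary is $\overline{\Gamma_1}\cup\Gamma$, where $\Gamma_1$ is a relatively open subset of the hyperplane $\{x_1=0\}$ and $\Gamma\subset\{x_1>0\}$ is a surface satisfying the following conditions: (i) at every point $\xi\in\Gamma$ there is a definite outer unit normal $n_\xi$ to $\partial\Omega$; (ii) there are constants $a,\beta>0$ such that for all $x,\xi\in\Gamma$ the angle between $n_x$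 and $n_\xi$ is at most $a\,|x-\xi|^{\beta}$; (iii) $\Gamma$ approaches the hyperplane $x_1=0$ under a right angle, i.e. for every point $p\in\overline\Gamma$ with $p_1=0$, $\cos(n_\xi,\xi_1)\to 0$ as $\xi\to p$, $\xi\in\Gamma$. Then there is a constant $C$ such that for all $x\in\mathbb R^m$ with $x_1\ge 0$ the function $\xi\mapsto \xi_1^{2\alpha}\left|\partial q_1(\xi,x)/\partial n_\xi\right|$ is integrable over $\Gamma$ with respect to the surface measure, and $$\int_\Gamma \xi_1^{2\alpha}\left|\frac{\partial q_1(\xi,x)}{\partial n_\xi}\right|\,d_\xi\Gamma\le C .$$ -/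

import Mathlib

open Set Filter Topology MeasureTheory
open scoped Nat RealInnerProductSpace

/-! ### The Gauss hypergeometric function on `(-∞, 1)` -/

/-- Gauss's hypergeometric function `F(a, b; c; z)` for real `z < 1`: the sum of the series
`∑ (a)ₙ (b)ₙ / (n! (c)ₙ) zⁿ` for `-1 < z < 1`, and its analytic continuation to `z ≤ -1`, given by
the transformation `F(a, b; c; z) = (1 - z)⁻ᵃ F(a, c - b; c; z / (z - 1))`, whose right-hand side
has its argument in `[1/2, 1)`. (The function is not used for `z ≥ 1`.) -/
noncomputable def gaussF (a b c z : ℝ) : ℝ :=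
  if -1 < z then ₂F₁ a b c z else (1 - z) ^ (-a) * ₂F₁ a (c - b) c (z / (z - 1))

/-! The next facts show that the two branches of `gaussF` fit together: for `0 < b < c` both are
given by Euler's integral, which is analytic in `z < 1`. -/

theorem integrableOn_betaKernel {u v : ℝ} (hu : 0 < u) (hv : 0 < v) :
    IntegrableOn (fun t : ℝ => t ^ (u - 1) * (1 - t) ^ (v - 1)) (Ioo 0 1) ∧
      ∫ t in Ioo (0 : ℝ) 1, t ^ (u - 1) * (1 - t) ^ (v - 1) =
        Real.Gamma u * Real.Gamma v / Real.Gamma (u + v) := by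
  have h1 := Complex.betaIntegral_convergent (u := u) (v := v) (by simpa) (by simpa)
  rw [intervalIntegrable_iff_integrableOn_Ioo_of_le zero_le_one] at h1
  have hcongr : ∀ t ∈ Ioo (0 : ℝ) 1, (((t ^ (u - 1) * (1 - t) ^ (v - 1) : ℝ)) : ℂ) =
      (t : ℂ) ^ ((u : ℂ) - 1) * (1 - (t : ℂ)) ^ ((v : ℂ) - 1) := by
    intro t ht
    rw [Complex.ofReal_mul, Complex.ofReal_cpow ht.1.le, Complex.ofReal_cpow (by linarith [ht.2])]
    push_cast
    rfl
  have h2 : IntegrableOn (fun t : ℝ => (((t ^ (u - 1) * (1 - t) ^ (v - 1) : ℝ)) : ℂ)) (Ioo 0 1) :=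
    h1.congr_fun (fun t ht => (hcongr t ht).symm) measurableSet_Ioo
  refine ⟨by simpa [IntegrableOn] using Integrable.re h2, ?_⟩
  have h3 := ProbabilityTheory.beta_eq_betaIntegralReal u v hu hv
  rw [ProbabilityTheory.beta] at h3
  rw [h3, Complex.betaIntegral, intervalIntegral.integral_of_le zero_le_one,
    integral_Ioc_eq_integral_Ioo, ← setIntegral_congr_fun measurableSet_Ioo hcongr,
    integral_complex_ofReal, Complex.ofReal_re]

theorem hasSum_one_sub_rpow_neg (a : ℝ) {s : ℝ} (hs : |s| < 1) :
    HasSum (fun n : ℕ => ((n ! : ℝ)⁻¹ * (ascPochhammer ℝ n).eval a) * s ^ n) ((1 - s) ^ (-a)) := by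
  have h := (Real.one_add_rpow_hasFPowerSeriesOnBall_zero (a := -a)).hasSum (y := -s)
    (by simpa [enorm_eq_nnnorm, ← NNReal.coe_lt_coe] using hs)
  rw [zero_add, ← sub_eq_add_neg] at h
  suffices e : (fun n : ℕ => ((n ! : ℝ)⁻¹ * (ascPochhammer ℝ n).eval a) * s ^ n) =
      fun n => (binomialSeries ℝ (-a) n) fun _ => -s by
    rw [e]; exact h
  funext n
  rw [binomialSeries_eq_ordinaryHypergeometricSeries (b := (1 : ℝ))
    (by intro k hk; have : (0 : ℝ) ≤ k := k.cast_nonneg; linarith)]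
  have h1 : (ascPochhammer ℝ n).eval 1 ≠ 0 := (ascPochhammer_pos n 1 one_pos).ne'
  rw [FormalMultilinearSeries.compContinuousLinearMap_apply]
  have := ordinaryHypergeometricSeries_apply_eq (𝔸 := ℝ) (- -a) 1 1 s n
  simp only [neg_neg] at this
  simp only [Function.comp_def, _root_.neg_apply, ContinuousLinearMap.id_apply, neg_neg]
  rw [this, mul_assoc _ _ _⁻¹, mul_inv_cancel₀ h1]
  simp

theorem Gamma_add_nat_eq {x : ℝ} (hx : 0 < x) (n : ℕ) :
    Real.Gamma (x + n) = (ascPochhammer ℝ n).eval x * Real.Gamma x := by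
  induction n with
  | zero => simp
  | succ n ih =>
    have hn : x + n ≠ 0 := by positivity
    rw [Nat.cast_succ, ← add_assoc, Real.Gamma_add_one hn, ih, ascPochhammer_succ_eval]
    ring

theorem ordinaryHypergeometric_eq_integral {a b c z : ℝ} (hb : 0 < b) (hbc : b < c)
    (hz : |z| < 1) :
    ₂F₁ a b c z = Real.Gamma c / (Real.Gamma b * Real.Gamma (c - b)) *
      ∫ t in Ioo (0 : ℝ) 1, t ^ (b - 1) * (1 - t) ^ (c - b - 1) * (1 - z * t) ^ (-a) := by
  set w : ℝ → ℝ := fun t => t ^ (b - 1) * (1 - t) ^ (c - b - 1) with hw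
  set p : ℕ → ℝ := fun n => (n ! : ℝ)⁻¹ * (ascPochhammer ℝ n).eval a with hp
  have hd : 0 < c - b := by linarith
  have hc : 0 < c := by linarith
  have hw0 : ∀ t ∈ Ioo (0 : ℝ) 1, 0 ≤ w t := fun t ht =>
    mul_nonneg (Real.rpow_nonneg ht.1.le _) (Real.rpow_nonneg (by linarith [ht.2]) _)
  have hmom : ∀ n : ℕ, IntegrableOn (fun t => t ^ n * w t) (Ioo 0 1) ∧
      ∫ t in Ioo (0 : ℝ) 1, t ^ n * w t = Real.Gamma (b + n) * Real.Gamma (c - b) /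
        Real.Gamma (c + n) := by
    intro n
    have h := integrableOn_betaKernel (u := b + n) (v := c - b) (by positivity) hd
    have e : ∀ t ∈ Ioo (0 : ℝ) 1, t ^ (b + n - 1) * (1 - t) ^ (c - b - 1) = t ^ n * w t := by
      intro t ht
      rw [hw, ← mul_assoc, ← Real.rpow_natCast, ← Real.rpow_add ht.1]
      ring_nf
    refine ⟨h.1.congr_fun e measurableSet_Ioo, ?_⟩
    rw [← setIntegral_congr_fun measurableSet_Ioo e, h.2]
    ring_nf
  have hint : ∀ n : ℕ, Integrable (fun t => p n * z ^ n * (t ^ n * w t))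
      (volume.restrict (Ioo (0 : ℝ) 1)) := fun n => (hmom n).1.const_mul _
  have hwi : IntegrableOn w (Ioo 0 1) := by simpa using (hmom 0).1
  have habs : Summable fun n => |p n * z ^ n| := by
    have := (hasSum_one_sub_rpow_neg a hz).summable
    exact this.abs
  have hsum : Summable fun n => ∫ t in Ioo (0 : ℝ) 1, ‖p n * z ^ n * (t ^ n * w t)‖ := by
    refine Summable.of_nonneg_of_le (fun n => integral_nonneg fun t => norm_nonneg _) (fun n => ?_)
      (habs.mul_right (∫ t in Ioo (0 : ℝ) 1, w t))
    rw [← integral_const_mul]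
    refine setIntegral_mono_on (hint n).norm (hwi.const_mul _) measurableSet_Ioo fun t ht => ?_
    rw [norm_mul, Real.norm_eq_abs, Real.norm_eq_abs,
      abs_of_nonneg (mul_nonneg (pow_nonneg ht.1.le _) (hw0 t ht))]
    exact mul_le_mul_of_nonneg_left
      (mul_le_of_le_one_left (hw0 t ht) (pow_le_one₀ ht.1.le ht.2.le)) (abs_nonneg _)
  have key := hasSum_integral_of_summable_integral_norm hint hsum
  have hR : ∫ t in Ioo (0 : ℝ) 1, (∑' n, p n * z ^ n * (t ^ n * w t)) =
      ∫ t in Ioo (0 : ℝ) 1, w t * (1 - z * t) ^ (-a) := by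
    refine setIntegral_congr_fun measurableSet_Ioo fun t ht => ?_
    have hzt : |z * t| < 1 := by
      rw [abs_mul, abs_of_pos ht.1]
      nlinarith [ht.1, ht.2, abs_nonneg z]
    have h := ((hasSum_one_sub_rpow_neg a hzt).mul_left (w t)).tsum_eq
    rw [← h]
    refine tsum_congr fun n => ?_
    rw [mul_pow, hp]
    ring
  rw [hR] at key
  rw [← key.tsum_eq, ordinaryHypergeometric_eq_tsum, ← tsum_mul_left]
  refine tsum_congr fun n => ?_
  have g1 := (Real.Gamma_pos_of_pos hb).ne'
  have g2 := (Real.Gamma_pos_of_pos hd).ne'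
  have g3 := (Real.Gamma_pos_of_pos hc).ne'
  have g4 := (ascPochhammer_pos n c hc).ne'
  rw [integral_const_mul, (hmom n).2, Gamma_add_nat_eq hb, Gamma_add_nat_eq hc, hp, smul_eq_mul]
  field_simp

/-- Euler's integral for `gaussF`, valid on both branches. -/
theorem gaussF_eq_integral {a b c z : ℝ} (hb : 0 < b) (hbc : b < c) (hz : z < 1) :
    gaussF a b c z = Real.Gamma c / (Real.Gamma b * Real.Gamma (c - b)) *
      ∫ t in Ioo (0 : ℝ) 1, t ^ (b - 1) * (1 - t) ^ (c - b - 1) * (1 - z * t) ^ (-a) := by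
  unfold gaussF
  split_ifs with h
  · exact ordinaryHypergeometric_eq_integral hb hbc (abs_lt.2 ⟨h, hz⟩)
  · have h1 : z - 1 < 0 := by linarith
    have hpos : 0 < 1 - z := by linarith
    have hw : |z / (z - 1)| < 1 := by
      rw [abs_div, abs_of_neg h1, div_lt_one (by linarith), abs_of_neg (by linarith)]
      linarith
    rw [ordinaryHypergeometric_eq_integral (by linarith) (by linarith) hw, sub_sub_cancel,
      mul_left_comm, mul_comm (Real.Gamma (c - b)), ← integral_const_mul]
    congr 1
    rw [← integral_Ioc_eq_integral_Ioo, ← integral_Ioc_eq_integral_Ioo,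
      ← intervalIntegral.integral_of_le zero_le_one, ← intervalIntegral.integral_of_le zero_le_one]
    have := intervalIntegral.integral_comp_sub_left (a := 0) (b := 1)
      (fun t : ℝ => t ^ (b - 1) * (1 - t) ^ (c - b - 1) * (1 - z * t) ^ (-a)) 1
    rw [sub_self, sub_zero] at this
    rw [← this]
    refine intervalIntegral.integral_congr fun t ht => ?_
    rw [uIcc_of_le zero_le_one] at ht
    have e : 1 - z * (1 - t) = (1 - z) * (1 - z / (z - 1) * t) := by
      field_simp [h1.ne]
      ring
    have hn : 0 ≤ 1 - z / (z - 1) * t := by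
      have : z / (z - 1) * t ≤ 1 := by
        have := abs_lt.1 hw
        nlinarith [ht.1, ht.2]
      linarith
    simp only [sub_sub_cancel]
    rw [e, Real.mul_rpow hpos.le hn]
    ring

/-! ### The fundamental solution -/

/-- `r² = ∑ (x_i - ξ_i)²`. -/
noncomputable def rSq {m : ℕ} (x ξ : EuclideanSpace ℝ (Fin m)) : ℝ :=
  ∑ i, (x i - ξ i) ^ 2

/-- `r₁² = (x₁ + ξ₁)² + ∑_{i ≥ 2} (x_i - ξ_i)²`; the coordinate `x₁` is `x 0`. -/
noncomputable def r1Sq {m : ℕ} [NeZero m] (x ξ : EuclideanSpace ℝ (Fin m)) : ℝ :=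
  (x 0 + ξ 0) ^ 2 + ∑ i ∈ Finset.univ.erase 0, (x i - ξ i) ^ 2

/-- The constant `k₁ = Γ(α) Γ(α + (m-2)/2) / (4^(1-α) π^(m/2) Γ(2α))`. -/
noncomputable def kOne (m : ℕ) (α : ℝ) : ℝ :=
  Real.Gamma α * Real.Gamma (α + ((m : ℝ) - 2) / 2) /
    ((4 : ℝ) ^ (1 - α) * Real.pi ^ ((m : ℝ) / 2) * Real.Gamma (2 * α))

/-- The fundamental solution
`q₁(x, ξ) = k₁ (r²)^(-α-(m-2)/2) F(α + (m-2)/2, α; 2α; ζ)`, `ζ = 1 - r₁² / r²`, of the equation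
`∑ u_{x_i x_i} + (2α / x₁) u_{x₁} = 0`. For `x₁, ξ₁ ≥ 0` and `x ≠ ξ` one has
`ζ = -4 x₁ ξ₁ / r² ≤ 0`. -/
noncomputable def qOne {m : ℕ} [NeZero m] (α : ℝ) (x ξ : EuclideanSpace ℝ (Fin m)) : ℝ :=
  kOne m α * rSq x ξ ^ (-α - ((m : ℝ) - 2) / 2) *
    gaussF (α + ((m : ℝ) - 2) / 2) α (2 * α) (1 - r1Sq x ξ / rSq x ξ)

/-- The derivative `∑ ν_i ∂f/∂ξ_i` of `f` at `ξ` in the direction of the unit vector `ν`. -/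
noncomputable def normalDeriv {m : ℕ} (f : EuclideanSpace ℝ (Fin m) → ℝ)
    (ν ξ : EuclideanSpace ℝ (Fin m)) : ℝ :=
  fderiv ℝ f ξ ν

/-! ### Lyapunov surfaces bounding a domain in the half-space -/

/-- `Ω` is a bounded domain in the half-space `x₁ > 0` whose boundary consists of the closure of a
relatively open part `Γ₁` of the hyperplane `x₁ = 0` and of `Γ`, which lies in `x₁ > 0`. -/
structure IsDomainBoundedBy {m : ℕ} [NeZero m] (Ω Γ₁ Γ : Set (EuclideanSpace ℝ (Fin m))) :
    Prop where
  isOpen : IsOpen Ω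
  isConnected : IsConnected Ω
  isBounded : Bornology.IsBounded Ω
  pos : ∀ x ∈ Ω, 0 < x 0
  base_isOpen : ∃ U : Set (EuclideanSpace ℝ (Fin m)), IsOpen U ∧ Γ₁ = U ∩ {x | x 0 = 0}
  surface_pos : ∀ x ∈ Γ, 0 < x 0
  frontier_eq : frontier Ω = closure Γ₁ ∪ Γ

/-- The unit vector `ν` is the outer normal at the point `p` to the boundary of `Ω`: the boundary
has at `p` the tangent hyperplane orthogonal to `ν`, with `Ω` on the side of `-ν`. That is, close
to `p`, every cone `⟪y - p, ν⟫ < -ε ‖y - p‖` lies in `Ω` and every cone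
`⟪y - p, ν⟫ > ε ‖y - p‖` lies outside of the closure of `Ω`. -/
def IsOuterNormal {m : ℕ} (Ω : Set (EuclideanSpace ℝ (Fin m)))
    (p ν : EuclideanSpace ℝ (Fin m)) : Prop :=
  ‖ν‖ = 1 ∧ ∀ ε : ℝ, 0 < ε → ∀ᶠ y in 𝓝 p,
    (⟪y - p, ν⟫ < -ε * ‖y - p‖ → y ∈ Ω) ∧ (ε * ‖y - p‖ < ⟪y - p, ν⟫ → y ∉ closure Ω)

/-- The surface `Γ`, a part of the boundary of `Ω`, is a Lyapunov surface with field of outer unit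
normals `n`: there is a definite normal at each point, the angle between the normals at two points
is Hölder continuous with some constant and some positive exponent, and `Γ` approaches the
hyperplane `x₁ = 0` under a right angle, i.e. `cos (n, x₁) = n 0` tends to zero at each edge
point of `Γ` in that hyperplane. -/
structure IsLyapunovSurface {m : ℕ} [NeZero m] (Ω Γ : Set (EuclideanSpace ℝ (Fin m)))
    (n : EuclideanSpace ℝ (Fin m) → EuclideanSpace ℝ (Fin m)) : Prop where
  normal : ∀ ξ ∈ Γ, IsOuterNormal Ω ξ (n ξ)
  holder : ∃ a β : ℝ, 0 < a ∧ 0 < β ∧ ∀ x ∈ Γ, ∀ ξ ∈ Γ,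
    InnerProductGeometry.angle (n x) (n ξ) ≤ a * dist x ξ ^ β
  right_angle : ∀ p ∈ closure Γ, p 0 = 0 → Tendsto (fun ξ => n ξ 0) (𝓝[Γ] p) (𝓝 0)

/-! Euler's integral turns q₁(ξ, x) into a constant times ∫₀¹ (t(1-t))^(α-1) (r² + 4x₁ξ₁t)^(-b) dt
with b = α + (m-2)/2. Differentiating under the integral and using the sharp size of such integrals,
R^(-σ) (R+c)^(-α), produces a factor r₁^(-2α). Since r₁ ≥ ξ₁ + x₁, the weight ξ₁^(2α) absorbs it,
and the weighted derivative is bounded by |⟪ξ - x, n⟫| r^(-m) + |n₁| r^(2-m) / r₁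
(`exists_normalDeriv_qOne_le`).

The first term is the classical double layer kernel. The Lyapunov inequality |⟪η - ξ, n_ξ⟫| ≤ a|η -
ξ|^(1+β) on Γ (`abs_inner_sub_normal_le`) and the point x' of the closure of Γ nearest to x, at
distance δ, bound it by a multiple of r^(β-(m-1)) + δ r^(-m). The second term needs a rate in the
right angle condition: |n₁| ≤ M ξ₁^β (`IsLyapunovSurface.exists_abs_normal_zero_le`), obtained by
comparing n at ξ with n at points of Γ near ξ whose height tends to zero. As ξ₁ and r are at most r₁
and β ≤ 1, this term is again at most a multiple of r^(β-(m-1)).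

Finally, Γ has surface measure at most Cρ^(m-1) in every ball of radius ρ, because small pieces of
it project bi-Lipschitzly into a hyperplane. Summing over dyadic shells bounds the integrals of
r^(β-(m-1)), and of δ r^(-m) over r ≥ δ, independently of x. -/

/-! ### Size of the Euler-type integrals -/

theorem integrableOn_rpow_mul_affine_rpow {α c R : ℝ} (hα : 0 < α) (hR : 0 < R) (hc : 0 ≤ c)
    (p : ℝ) : IntegrableOn (fun t : ℝ => t ^ (α - 1) * (R + c * t) ^ p) (Icc 0 1) := by
  have h : IntegrableOn (fun t : ℝ => t ^ (α - 1)) (Icc 0 1) := by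
    rw [integrableOn_Icc_iff_integrableOn_Ioc, ← intervalIntegrable_iff_integrableOn_Ioc_of_le
      zero_le_one]
    exact intervalIntegral.intervalIntegrable_rpow' (by linarith)
  refine h.mul_continuousOn (fun t ht => ?_) isCompact_Icc
  have : R + c * t ≠ 0 := by have := mul_nonneg hc ht.1; linarith
  have h3 : ContinuousAt (fun t => R + c * t) t := by fun_prop
  exact (h3.rpow_const (Or.inl this)).continuousWithinAt

/-- The bound `∫₀¹ tᵅ⁻¹ (R + c t)^(-α-σ) dt ≲ R^(-σ) (R + c)^(-α)`. -/
theorem integral_rpow_mul_affine_rpow_le {α σ c R : ℝ} (hα : 0 < α) (hσ : 0 < σ) (hR : 0 < R)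
    (hc : 0 ≤ c) :
    ∫ t in Ioo (0 : ℝ) 1, t ^ (α - 1) * (R + c * t) ^ (-α - σ) ≤
      2 / min α σ * (R ^ (-σ) * (R + c) ^ (-α)) := by
  set κ := min α σ with hκ
  have hκ0 : 0 < κ := lt_min hα hσ
  have hX : ∀ t : ℝ, 0 ≤ t → R ≤ R + c * t := fun t ht => by
    have := mul_nonneg hc ht; linarith
  -- An explicit majorant primitive. With X = R + ct, the derivative of (t/X)^α yields the part of
  -- the integrand carrying R, that of -X^(-σ) the part carrying ct. The coefficient 2 keeps the
  -- last factor at least X^(-σ), because X ≥ R.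
  set g : ℝ → ℝ := fun t => t ^ α * (R + c * t) ^ (-α) * (2 * R ^ (-σ) - (R + c * t) ^ (-σ))
    with hg
  have key : ∫ t in (0 : ℝ)..1, κ * (t ^ (α - 1) * (R + c * t) ^ (-α - σ)) ≤ g 1 - g 0 :=
    intervalIntegral.integral_le_sub_of_hasDeriv_right_of_le
    (g' := fun t => (α * t ^ (α - 1) * (R + c * t) ^ (-α) +
        t ^ α * (c * (-α) * (R + c * t) ^ (-α - 1))) * (2 * R ^ (-σ) - (R + c * t) ^ (-σ)) +
        t ^ α * (R + c * t) ^ (-α) * (-(c * (-σ) * (R + c * t) ^ (-σ - 1))))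
    zero_le_one ?_ ?_ ((integrableOn_rpow_mul_affine_rpow hα hR hc _).const_mul κ) ?_
  · rw [intervalIntegral.integral_of_le zero_le_one, integral_Ioc_eq_integral_Ioo,
      integral_const_mul] at key
    rw [div_mul_eq_mul_div, le_div_iff₀ hκ0, mul_comm]
    refine key.trans ?_
    simp only [hg, Real.zero_rpow hα.ne', Real.one_rpow, mul_one, one_mul, zero_mul, sub_zero]
    have h1 : 0 ≤ (R + c) ^ (-σ) := Real.rpow_nonneg (by linarith) _
    have h2 : 0 ≤ (R + c) ^ (-α) := Real.rpow_nonneg (by linarith) _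
    nlinarith
  · intro t ht
    have : R + c * t ≠ 0 := (hR.trans_le (hX t ht.1)).ne'
    refine ContinuousAt.continuousWithinAt ?_
    have h3 : ContinuousAt (fun t => R + c * t) t := by fun_prop
    exact ((continuousAt_id.rpow_const (Or.inr hα.le)).mul (h3.rpow_const (Or.inl this))).mul
      (continuousAt_const.sub (h3.rpow_const (Or.inl this)))
  · intro t ht
    have h0 : R + c * t ≠ 0 := (hR.trans_le (hX t ht.1.le)).ne'
    have h3 : HasDerivAt (fun t => R + c * t) c t := by
      simpa using ((hasDerivAt_id t).const_mul c).const_add R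
    have h4 : HasDerivAt (fun t : ℝ => t ^ α) (α * t ^ (α - 1)) t :=
      Real.hasDerivAt_rpow_const (Or.inl ht.1.ne')
    exact ((h4.mul (h3.rpow_const (Or.inl h0))).mul
      ((h3.rpow_const (Or.inl h0)).const_sub (2 * R ^ (-σ)))).hasDerivWithinAt
  · intro t ht
    have ht0 := ht.1
    set X := R + c * t with hXd
    have hX0 : 0 < X := hR.trans_le (hX t ht0.le)
    have e1 : t ^ α = t ^ (α - 1) * t := by
      rw [← Real.rpow_add_one ht0.ne']; ring_nf
    have e2 : X ^ (-α) = X ^ (-α - σ - 1) * X ^ σ * X := by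
      rw [← Real.rpow_add hX0, ← Real.rpow_add_one hX0.ne']; ring_nf
    have e3 : X ^ (-α - 1) = X ^ (-α - σ - 1) * X ^ σ := by
      rw [← Real.rpow_add hX0]; ring_nf
    have e4 : X ^ (-σ - 1) * X = X ^ (-σ) := by
      rw [← Real.rpow_add_one hX0.ne']; ring_nf
    have e5 : X ^ (-α - σ) = X ^ (-α - σ - 1) * X := by
      rw [← Real.rpow_add_one hX0.ne']; ring_nf
    have e6 : X ^ σ * X ^ (-σ) = 1 := by rw [← Real.rpow_add hX0]; simp
    have hmono : X ^ (-σ) ≤ R ^ (-σ) :=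
      Real.rpow_le_rpow_of_nonpos hR (hX t ht0.le) (by linarith)
    set P := t ^ (α - 1) * X ^ (-α - σ - 1) with hP
    have hP0 : 0 ≤ P := by positivity
    have hXs : 0 < X ^ σ := by positivity
    have h1 : 1 ≤ X ^ σ * (2 * R ^ (-σ) - X ^ (-σ)) := by nlinarith
    have hexp : (α * t ^ (α - 1) * X ^ (-α) + t ^ α * (c * (-α) * X ^ (-α - 1))) *
        (2 * R ^ (-σ) - X ^ (-σ)) + t ^ α * X ^ (-α) * (-(c * (-σ) * X ^ (-σ - 1))) =
        P * (α * R * (X ^ σ * (2 * R ^ (-σ) - X ^ (-σ))) + σ * (c * t)) := by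
      have : X ^ σ * (X ^ (-σ - 1) * X) = 1 := by rw [e4, e6]
      rw [e1, e2, e3, hP]
      have hc' : c * t = X - R := by rw [hXd]; ring
      linear_combination (t ^ (α - 1) * t * X ^ (-α - σ - 1) * c * σ) * this -
        α * t ^ (α - 1) * X ^ (-α - σ - 1) * X ^ σ * (2 * R ^ (-σ) - X ^ (-σ)) * hc'
    have : κ * (t ^ (α - 1) * X ^ (-α - σ)) = P * (κ * R + κ * (c * t)) := by
      rw [e5, hP, hXd]; ring
    rw [hexp, this]
    refine mul_le_mul_of_nonneg_left ?_ hP0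
    have hct : 0 ≤ c * t := by positivity
    have k1 : κ ≤ α := min_le_left _ _
    have k2 : κ ≤ σ := min_le_right _ _
    have := mul_le_mul_of_nonneg_right k2 hct
    have := mul_le_mul_of_nonneg_right k1 hR.le
    have : 0 ≤ α * R := by positivity
    nlinarith

/-- Split at t = 1/2, so that only one endpoint singularity remains on each half. For t ≥ 1/2 the
affine factor is moreover comparable to its value at t = 1. -/
theorem betaKernel_mul_affine_rpow_le {α p c R t : ℝ} (hα1 : α < 1) (hp : 0 ≤ p) (hR : 0 < R)
    (hc : 0 ≤ c) (ht : t ∈ Ioo (0 : ℝ) 1) :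
    t ^ (α - 1) * (1 - t) ^ (α - 1) * (R + c * t) ^ (-p) ≤
      2 ^ (1 - α) * (t ^ (α - 1) * (R + c * t) ^ (-p) +
        (1 - t) ^ (α - 1) * ((R + c) / 2) ^ (-p)) := by
  have h : ∀ s : ℝ, 1 / 2 ≤ s → s ^ (α - 1) ≤ 2 ^ (1 - α) := fun s hs => by
    rw [show (2 : ℝ) ^ (1 - α) = (1 / 2) ^ (α - 1) by
      rw [one_div, Real.inv_rpow (by norm_num), ← Real.rpow_neg (by norm_num)]; ring_nf]
    exact Real.rpow_le_rpow_of_nonpos (by norm_num) hs (by linarith)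
  have h1 : 0 ≤ t ^ (α - 1) := Real.rpow_nonneg ht.1.le _
  have h2 : 0 ≤ (1 - t) ^ (α - 1) := Real.rpow_nonneg (by linarith [ht.2]) _
  have hX : 0 < R + c * t := by have := mul_nonneg hc ht.1.le; linarith
  have h3 : 0 ≤ (R + c * t) ^ (-p) := by positivity
  have h4 : 0 ≤ ((R + c) / 2) ^ (-p) := by positivity
  have h5 : (0 : ℝ) < 2 ^ (1 - α) := by positivity
  rcases le_total (1 / 2) t with h' | h'
  · have hmono : (R + c * t) ^ (-p) ≤ ((R + c) / 2) ^ (-p) :=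
      Real.rpow_le_rpow_of_nonpos (by positivity) (by nlinarith) (by linarith)
    calc _ ≤ 2 ^ (1 - α) * (1 - t) ^ (α - 1) * ((R + c) / 2) ^ (-p) := by
          gcongr
          exact h t h'
      _ ≤ _ := by
          rw [mul_assoc]
          gcongr
          have := mul_nonneg h1 h3
          linarith
  · calc _ ≤ t ^ (α - 1) * 2 ^ (1 - α) * (R + c * t) ^ (-p) := by
          gcongr
          exact h (1 - t) (by linarith)
      _ = 2 ^ (1 - α) * (t ^ (α - 1) * (R + c * t) ^ (-p)) := by ring
      _ ≤ _ := by
          gcongr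
          have := mul_nonneg h2 h4
          linarith

theorem integrableOn_betaKernel_mul_affine_rpow {α c R : ℝ} (hα : 0 < α) (hR : 0 < R)
    (hc : 0 ≤ c) (p : ℝ) :
    IntegrableOn (fun t : ℝ => t ^ (α - 1) * (1 - t) ^ (α - 1) * (R + c * t) ^ p) (Ioo 0 1) := by
  refine (integrableOn_betaKernel hα hα).1.mul_continuousOn_of_subset (K := Icc 0 1)
    (fun t ht => ?_) measurableSet_Ioo isCompact_Icc Ioo_subset_Icc_self
  have : R + c * t ≠ 0 := by have := mul_nonneg hc ht.1; linarith
  have h3 : ContinuousAt (fun t => R + c * t) t := by fun_prop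
  exact (h3.rpow_const (Or.inl this)).continuousWithinAt

/-- The bound `∫₀¹ (t (1 - t))ᵅ⁻¹ (R + c t)^(-α-σ) dt ≲ R^(-σ) (R + c)^(-α)`. -/
theorem exists_integral_betaKernel_mul_affine_rpow_le {α σ : ℝ} (hα : 0 < α) (hα1 : α < 1)
    (hσ : 0 < σ) : ∃ K : ℝ, 0 < K ∧ ∀ R c : ℝ, 0 < R → 0 ≤ c →
      ∫ t in Ioo (0 : ℝ) 1, t ^ (α - 1) * (1 - t) ^ (α - 1) * (R + c * t) ^ (-(α + σ)) ≤
        K * (R ^ (-σ) * (R + c) ^ (-α)) := by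
  have hκ0 : 0 < min α σ := lt_min hα hσ
  refine ⟨2 ^ (1 - α) * (2 / min α σ + 1 / α * 2 ^ (α + σ)), by positivity, fun R c hR hc => ?_⟩
  have hi1 : IntegrableOn (fun t : ℝ => t ^ (α - 1) * (R + c * t) ^ (-(α + σ))) (Ioo 0 1) :=
    (integrableOn_rpow_mul_affine_rpow hα hR hc _).mono_set Ioo_subset_Icc_self
  have hb := integrableOn_betaKernel one_pos hα
  simp only [sub_self, Real.rpow_zero, one_mul, Real.Gamma_one] at hb
  have hb2 : ∫ t in Ioo (0 : ℝ) 1, (1 - t) ^ (α - 1) = 1 / α := by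
    rw [hb.2, add_comm, Real.Gamma_add_one hα.ne']
    have := (Real.Gamma_pos_of_pos hα).ne'
    field_simp
  have hi2 : IntegrableOn (fun t : ℝ => (1 - t) ^ (α - 1) * ((R + c) / 2) ^ (-(α + σ)))
    (Ioo 0 1) := hb.1.mul_const _
  have hle := setIntegral_mono_on (integrableOn_betaKernel_mul_affine_rpow hα hR hc (-(α + σ)))
    ((hi1.add hi2).const_mul (2 ^ (1 - α))) measurableSet_Ioo
    (fun t ht => betaKernel_mul_affine_rpow_le hα1 (by linarith) hR hc ht)
  refine hle.trans ?_
  simp only [Pi.add_apply]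
  rw [integral_const_mul, integral_add hi1 hi2, integral_mul_const, hb2, mul_assoc]
  have hRc : 0 < R + c := by linarith
  have h2 : ((R + c) / 2) ^ (-(α + σ)) ≤ 2 ^ (α + σ) * (R ^ (-σ) * (R + c) ^ (-α)) := by
    rw [Real.div_rpow hRc.le (by norm_num), Real.rpow_neg (by norm_num : (0 : ℝ) ≤ 2), div_inv_eq_mul,
      mul_comm, neg_add, Real.rpow_add hRc, mul_comm (R ^ _)]
    have : (R + c) ^ (-σ) ≤ R ^ (-σ) :=
      Real.rpow_le_rpow_of_nonpos hR (by linarith) (by linarith)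
    gcongr
  have h1 := integral_rpow_mul_affine_rpow_le hα hσ hR hc
  rw [← neg_add'] at h1
  have h3 : 0 < 1 / α := by positivity
  refine mul_le_mul_of_nonneg_left ?_ (by positivity)
  have := mul_le_mul_of_nonneg_left h2 h3.le
  linarith

/-! ### The kernel and its normal derivative -/

theorem rSq_eq_norm_sq {m : ℕ} (x ξ : EuclideanSpace ℝ (Fin m)) : rSq x ξ = ‖x - ξ‖ ^ 2 := by
  rw [EuclideanSpace.real_norm_sq_eq]; rfl

theorem r1Sq_eq_rSq_add {m : ℕ} [NeZero m] (x ξ : EuclideanSpace ℝ (Fin m)) :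
    r1Sq x ξ = rSq x ξ + 4 * ξ 0 * x 0 := by
  rw [r1Sq, rSq, ← Finset.add_sum_erase _ _ (Finset.mem_univ (0 : Fin m))]
  ring

/-- Here ζ = -4x₁η₁/r², so the power of r² merges with (1 - ζt)^(-b) into a single power of r²(1 -
ζt) = r² + 4x₁η₁t. No singularity of F at infinity is left to study. -/
theorem qOne_eq_integral {m : ℕ} [NeZero m] {α : ℝ} (hα : 0 < α)
    {η x : EuclideanSpace ℝ (Fin m)} (hx : 0 ≤ x 0) (hη : 0 ≤ η 0) (hne : η ≠ x) :
    qOne α η x = kOne m α * (Real.Gamma (2 * α) / (Real.Gamma α * Real.Gamma α)) *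
      ∫ t in Ioo (0 : ℝ) 1, t ^ (α - 1) * (1 - t) ^ (α - 1) *
        (‖η - x‖ ^ 2 + 4 * x 0 * η 0 * t) ^ (-(α + ((m : ℝ) - 2) / 2)) := by
  have hR : 0 < rSq η x := by
    rw [rSq_eq_norm_sq]; have := norm_pos_iff.2 (sub_ne_zero.2 hne); positivity
  have hc : 0 ≤ 4 * x 0 * η 0 := by positivity
  have hz : 1 - r1Sq η x / rSq η x = - (4 * x 0 * η 0 / rSq η x) := by
    rw [r1Sq_eq_rSq_add]; field_simp; ring
  have hz0 : 0 ≤ 4 * x 0 * η 0 / rSq η x := by positivity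
  rw [qOne, gaussF_eq_integral hα (by linarith) (by rw [hz]; linarith), mul_assoc, mul_assoc,
    mul_left_comm (rSq η x ^ _), ← integral_const_mul, two_mul α, add_sub_cancel_right]
  congr 2
  refine setIntegral_congr_fun measurableSet_Ioo fun t ht => ?_
  have h1 : 0 ≤ 1 - (1 - r1Sq η x / rSq η x) * t := by
    rw [hz]; nlinarith [ht.1, mul_nonneg hz0 ht.1.le]
  have h2 : ‖η - x‖ ^ 2 + 4 * x 0 * η 0 * t =
      rSq η x * (1 - (1 - r1Sq η x / rSq η x) * t) := by
    rw [hz, ← rSq_eq_norm_sq]; field_simp; ring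
  simp only []
  rw [h2, Real.mul_rpow hR.le h1]
  ring_nf

/-- Dominated differentiation under the integral. In the ball about ξ of radius half the distance to
x, cut by the open half-space, the affine base stays above a positive constant, and a multiple of
the beta weight dominates. -/
theorem hasFDerivAt_integral_betaKernel {m : ℕ} [NeZero m] {α b : ℝ} (hα : 0 < α) (hb : 0 < b)
    {ξ x : EuclideanSpace ℝ (Fin m)} (hx : 0 ≤ x 0) (hξ : 0 < ξ 0) (hne : ξ ≠ x) :
    ∃ L : EuclideanSpace ℝ (Fin m) →L[ℝ] ℝ,
      HasFDerivAt (fun η : EuclideanSpace ℝ (Fin m) =>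
        ∫ t in Ioo (0 : ℝ) 1, t ^ (α - 1) * (1 - t) ^ (α - 1) *
          (‖η - x‖ ^ 2 + 4 * x 0 * η 0 * t) ^ (-b)) L ξ ∧
      ∀ ν, L ν = ∫ t in Ioo (0 : ℝ) 1, t ^ (α - 1) * (1 - t) ^ (α - 1) *
          (-b * (‖ξ - x‖ ^ 2 + 4 * x 0 * ξ 0 * t) ^ (-b - 1) *
            (2 * ⟪ξ - x, ν⟫ + 4 * x 0 * t * ν 0)) := by
  set w : ℝ → ℝ := fun t => t ^ (α - 1) * (1 - t) ^ (α - 1) with hw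
  have hwi : IntegrableOn w (Ioo 0 1) := (integrableOn_betaKernel hα hα).1
  set D : EuclideanSpace ℝ (Fin m) → ℝ → (EuclideanSpace ℝ (Fin m) →L[ℝ] ℝ) := fun η t =>
    (2 : ℝ) • innerSL ℝ (η - x) + (4 * x 0 * t) •
      (EuclideanSpace.proj 0 : EuclideanSpace ℝ (Fin m) →L[ℝ] ℝ) with hD
  set F' : EuclideanSpace ℝ (Fin m) → ℝ → (EuclideanSpace ℝ (Fin m) →L[ℝ] ℝ) := fun η t =>
    (w t * (-b * (‖η - x‖ ^ 2 + 4 * x 0 * η 0 * t) ^ (-b - 1))) • D η t with hF'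
  set d := ‖ξ - x‖ with hd
  have hd0 : 0 < d := norm_pos_iff.2 (sub_ne_zero.2 hne)
  set s : Set (EuclideanSpace ℝ (Fin m)) := Metric.ball ξ (d / 2) ∩ {η | 0 < η 0} with hs
  have hsn : s ∈ 𝓝 ξ := by
    refine inter_mem (Metric.ball_mem_nhds _ (by positivity)) ?_
    exact (isOpen_lt continuous_const (EuclideanSpace.proj (𝕜 := ℝ) 0).continuous).mem_nhds hξ
  have hsd : ∀ η ∈ s, d / 2 ≤ ‖η - x‖ ∧ ‖η - x‖ ≤ 2 * d := fun η hη => by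
    have h1 : ‖η - ξ‖ < d / 2 := by simpa [dist_eq_norm] using hη.1
    constructor
    · have : d ≤ ‖η - ξ‖ + ‖η - x‖ := by
        rw [hd, ← norm_neg (η - ξ)]
        have h := norm_add_le (-(η - ξ)) (η - x)
        rwa [show -(η - ξ) + (η - x) = ξ - x by abel] at h
      linarith
    · have : ‖η - x‖ ≤ ‖η - ξ‖ + d := by
        have h := norm_add_le (η - ξ) (ξ - x)
        rwa [sub_add_sub_cancel] at h
      linarith
  have hX : ∀ η ∈ s, ∀ t ∈ Ioo (0 : ℝ) 1, (d / 2) ^ 2 ≤ ‖η - x‖ ^ 2 + 4 * x 0 * η 0 * t := by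
    intro η hη t ht
    have h1 : (d / 2) ^ 2 ≤ ‖η - x‖ ^ 2 := pow_le_pow_left₀ (by positivity) (hsd η hη).1 2
    have h2 : 0 ≤ 4 * x 0 * η 0 * t := by
      have h3 : 0 < η 0 := hη.2
      have := ht.1.le
      positivity
    linarith
  have hcont : ∀ η : EuclideanSpace ℝ (Fin m), η ∈ s → ∀ p : ℝ, ContinuousOn
      (fun t : ℝ => (‖η - x‖ ^ 2 + 4 * x 0 * η 0 * t) ^ p) (Ioo 0 1) := by
    intro η hη p t ht
    have h3 : ContinuousAt (fun t => ‖η - x‖ ^ 2 + 4 * x 0 * η 0 * t) t := by fun_prop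
    refine (h3.rpow_const (Or.inl ?_)).continuousWithinAt
    exact (lt_of_lt_of_le (by positivity) (hX η hη t ht)).ne'
  have hξs : ξ ∈ s := mem_of_mem_nhds hsn
  have hint : ∀ p : ℝ, Integrable (fun t => w t * (‖ξ - x‖ ^ 2 + 4 * x 0 * ξ 0 * t) ^ p)
      (volume.restrict (Ioo 0 1)) := fun p =>
    integrableOn_betaKernel_mul_affine_rpow hα (by positivity) (by positivity) p
  have hDn : ∀ η ∈ s, ∀ t ∈ Ioo (0 : ℝ) 1, ‖D η t‖ ≤
      4 * d + 4 * x 0 * ‖(EuclideanSpace.proj 0 : EuclideanSpace ℝ (Fin m) →L[ℝ] ℝ)‖ := by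
    intro η hη t ht
    refine (norm_add_le _ _).trans ?_
    rw [norm_smul, norm_smul, innerSL_apply_norm, Real.norm_eq_abs, Real.norm_eq_abs,
      abs_of_nonneg (by norm_num : (0 : ℝ) ≤ 2), abs_of_nonneg (by have := ht.1.le; positivity)]
    have h1 := (hsd η hη).2
    have h2 : 4 * x 0 * t ≤ 4 * x 0 := mul_le_of_le_one_right (by positivity) ht.2.le
    have h3 : 2 * ‖η - x‖ ≤ 4 * d := by linarith
    gcongr
  have hF'm : AEStronglyMeasurable (F' ξ) (volume.restrict (Ioo 0 1)) := by
    refine (hwi.aestronglyMeasurable.mul ?_).smul ?_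
    · exact ((hcont ξ hξs _).aestronglyMeasurable measurableSet_Ioo).const_mul (-b)
    · exact Continuous.aestronglyMeasurable (by fun_prop)
  set B : ℝ := b * ((d / 2) ^ 2) ^ (-b - 1) *
    (4 * d + 4 * x 0 * ‖(EuclideanSpace.proj 0 : EuclideanSpace ℝ (Fin m) →L[ℝ] ℝ)‖) with hB
  have hbound : ∀ η ∈ s, ∀ t ∈ Ioo (0 : ℝ) 1, ‖F' η t‖ ≤ w t * B := by
    intro η hη t ht
    have hw0 : 0 ≤ w t := mul_nonneg (Real.rpow_nonneg ht.1.le _)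
      (Real.rpow_nonneg (by linarith [ht.2]) _)
    have hX' := hX η hη t ht
    have hXp : 0 < ‖η - x‖ ^ 2 + 4 * x 0 * η 0 * t := lt_of_lt_of_le (by positivity) hX'
    have h1 : (‖η - x‖ ^ 2 + 4 * x 0 * η 0 * t) ^ (-b - 1) ≤ ((d / 2) ^ 2) ^ (-b - 1) :=
      Real.rpow_le_rpow_of_nonpos (by positivity) hX' (by linarith)
    have h2 : 0 ≤ (‖η - x‖ ^ 2 + 4 * x 0 * η 0 * t) ^ (-b - 1) := by positivity
    change ‖(w t * (-b * _)) • D η t‖ ≤ _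
    rw [norm_smul, norm_mul (w t), norm_mul (-b), norm_neg, Real.norm_of_nonneg hw0,
      Real.norm_of_nonneg hb.le, Real.norm_of_nonneg h2, mul_assoc]
    have := hDn η hη t ht
    rw [hB]
    gcongr
  have hF'i : Integrable (F' ξ) (volume.restrict (Ioo 0 1)) :=
    (hwi.mul_const B).mono' hF'm ((ae_restrict_mem measurableSet_Ioo).mono (hbound ξ hξs))
  refine ⟨∫ t in Ioo (0 : ℝ) 1, F' ξ t, hasFDerivAt_integral_of_dominated_of_fderiv_le hsn
    ?_ (hint (-b)) hF'm ((ae_restrict_mem measurableSet_Ioo).mono fun t ht η hη => hbound η hη t ht)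
    (hwi.mul_const B) ((ae_restrict_mem measurableSet_Ioo).mono fun t ht η hη => ?_), fun ν => ?_⟩
  · filter_upwards [hsn] with η hη
    exact hwi.aestronglyMeasurable.mul ((hcont η hη _).aestronglyMeasurable measurableSet_Ioo)
  · have h1 : HasFDerivAt (fun η : EuclideanSpace ℝ (Fin m) => ‖η - x‖ ^ 2) ((2 : ℝ) • innerSL ℝ (η - x)) η := by
      have := ((hasFDerivAt_id η).sub_const x).norm_sq
      convert! this using 1
      ext v; simp
    have h2 : HasFDerivAt (fun η : EuclideanSpace ℝ (Fin m) => 4 * x 0 * η 0 * t)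
        ((4 * x 0 * t) • (EuclideanSpace.proj 0 : EuclideanSpace ℝ (Fin m) →L[ℝ] ℝ)) η := by
      have := ((EuclideanSpace.proj 0 : EuclideanSpace ℝ (Fin m) →L[ℝ] ℝ).hasFDerivAt (x := η)).const_mul (4 * x 0 * t)
      convert! this using 2
      simp; ring
    have hXp : 0 < ‖η - x‖ ^ 2 + 4 * x 0 * η 0 * t :=
      lt_of_lt_of_le (by positivity) (hX η hη t ht)
    have h3 := ((h1.add h2).rpow_const (p := -b) (Or.inl hXp.ne')).const_mul (w t)
    convert! h3 using 1
    rw [hF', smul_smul]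
    rfl
  · rw [ContinuousLinearMap.integral_apply hF'i]
    refine setIntegral_congr_fun measurableSet_Ioo fun t ht => ?_
    have h0 : (EuclideanSpace.proj 0 : EuclideanSpace ℝ (Fin m) →L[ℝ] ℝ) ν = ν 0 := rfl
    simp only [hF', hD, hw, _root_.smul_apply, _root_.add_apply,
      innerSL_apply_apply, h0, smul_eq_mul, ← hd]
    ring

theorem sq_add_le_norm_sub_sq_add {m : ℕ} [NeZero m] (ξ x : EuclideanSpace ℝ (Fin m)) :
    (ξ 0 + x 0) ^ 2 ≤ ‖ξ - x‖ ^ 2 + 4 * x 0 * ξ 0 := by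
  have : |(ξ - x) 0| ≤ ‖ξ - x‖ := PiLp.norm_apply_le (ξ - x) 0
  have h := sq_le_sq' (by linarith [neg_abs_le ‖ξ - x‖, abs_nonneg ((ξ - x) 0)]) this
  rw [sq_abs, PiLp.sub_apply] at h
  nlinarith

theorem exists_normalDeriv_qOne_le {m : ℕ} [NeZero m] (hm : 2 < m) {α : ℝ} (hα : 0 < α)
    (hα1 : α < 1) : ∃ K : ℝ, 0 < K ∧ ∀ ξ x ν : EuclideanSpace ℝ (Fin m), 0 ≤ x 0 → 0 < ξ 0 →
      ξ ≠ x → ξ 0 ^ (2 * α) * |normalDeriv (fun η => qOne α η x) ν ξ| ≤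
        K * (|⟪ξ - x, ν⟫| * ‖ξ - x‖ ^ (-(m : ℝ)) +
          |ν 0| * (‖ξ - x‖ ^ (2 - (m : ℝ)) / √(‖ξ - x‖ ^ 2 + 4 * x 0 * ξ 0))) := by
  have hm' : (2 : ℝ) < m := by exact_mod_cast hm
  obtain ⟨K₁, hK₁, hJ₁⟩ := exists_integral_betaKernel_mul_affine_rpow_le hα hα1
    (show (0 : ℝ) < m / 2 by linarith)
  -- Positivity of this exponent is where m > 2 enters.
  obtain ⟨K₂, hK₂, hJ₂⟩ := exists_integral_betaKernel_mul_affine_rpow_le hα hα1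
    (show (0 : ℝ) < m / 2 - 1 by linarith)
  set b : ℝ := α + ((m : ℝ) - 2) / 2 with hb
  have hb0 : 0 < b := by have : 0 < ((m : ℝ) - 2) / 2 := by linarith
                         linarith
  set C := kOne m α * (Real.Gamma (2 * α) / (Real.Gamma α * Real.Gamma α)) with hC
  refine ⟨|C| * (b * (2 * K₁ + 4 * K₂)) + 1, by positivity, fun ξ x ν hx hξ hne => ?_⟩
  obtain ⟨L, hL, hLν⟩ := hasFDerivAt_integral_betaKernel hα hb0 hx hξ hne
  have hev : (fun η => qOne α η x) =ᶠ[𝓝 ξ] fun η => C * ∫ t in Ioo (0 : ℝ) 1,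
      t ^ (α - 1) * (1 - t) ^ (α - 1) * (‖η - x‖ ^ 2 + 4 * x 0 * η 0 * t) ^ (-b) := by
    have h1 : ∀ᶠ η : EuclideanSpace ℝ (Fin m) in 𝓝 ξ, 0 < η 0 :=
      (isOpen_lt continuous_const (EuclideanSpace.proj (𝕜 := ℝ) 0).continuous).mem_nhds hξ
    filter_upwards [h1, eventually_ne_nhds hne] with η hη hη'
    exact qOne_eq_integral hα hx hη.le hη'
  have hder : normalDeriv (fun η => qOne α η x) ν ξ = C * L ν := by
    rw [normalDeriv, ((hL.const_mul C).congr_of_eventuallyEq hev).fderiv]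
    rfl
  set r := ‖ξ - x‖ with hr
  have hr0 : 0 < r := norm_pos_iff.2 (sub_ne_zero.2 hne)
  set c := 4 * x 0 * ξ 0 with hc
  have hc0 : 0 ≤ c := by positivity
  have hR : 0 < r ^ 2 := by positivity
  set A := |⟪ξ - x, ν⟫| with hA
  have hLb : |L ν| ≤ b * (2 * A * ∫ t in Ioo (0 : ℝ) 1, t ^ (α - 1) * (1 - t) ^ (α - 1) *
        (r ^ 2 + c * t) ^ (-(α + (m : ℝ) / 2))) + b * (4 * x 0 * |ν 0| / (r ^ 2 + c) *
        ∫ t in Ioo (0 : ℝ) 1, t ^ (α - 1) * (1 - t) ^ (α - 1) *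
        (r ^ 2 + c * t) ^ (-(α + ((m : ℝ) / 2 - 1)))) := by
    rw [hLν, ← Real.norm_eq_abs, ← integral_const_mul, ← integral_const_mul,
      ← integral_const_mul, ← integral_const_mul, ← integral_add]
    rotate_left
    · exact ((integrableOn_betaKernel_mul_affine_rpow hα hR hc0 _).const_mul _).const_mul _
    · exact ((integrableOn_betaKernel_mul_affine_rpow hα hR hc0 _).const_mul _).const_mul _
    refine norm_integral_le_of_norm_le ?_ ?_
    · exact (((integrableOn_betaKernel_mul_affine_rpow hα hR hc0 _).const_mul _).const_mul _).add
        (((integrableOn_betaKernel_mul_affine_rpow hα hR hc0 _).const_mul _).const_mul _)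
    · refine (ae_restrict_mem measurableSet_Ioo).mono fun t ht => ?_
      have hw : 0 ≤ t ^ (α - 1) * (1 - t) ^ (α - 1) := mul_nonneg (Real.rpow_nonneg ht.1.le _)
        (Real.rpow_nonneg (by linarith [ht.2]) _)
      set X := r ^ 2 + c * t with hX
      have hXp : 0 < X := by have := mul_nonneg hc0 ht.1.le; linarith
      have e1 : X ^ (-b - 1) = X ^ (-(α + (m : ℝ) / 2)) := by rw [hb]; ring_nf
      have e2 : X ^ (-(α + ((m : ℝ) / 2 - 1))) = X ^ (-(α + (m : ℝ) / 2)) * X := by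
        rw [← Real.rpow_add_one hXp.ne']; ring_nf
      have hp : 0 ≤ X ^ (-(α + (m : ℝ) / 2)) := by positivity
      rw [norm_mul, Real.norm_of_nonneg hw, norm_mul, norm_mul (-b), norm_neg,
        Real.norm_of_nonneg hb0.le, e1, Real.norm_of_nonneg hp, e2]
      have h1 : ‖2 * ⟪ξ - x, ν⟫ + 4 * x 0 * t * ν 0‖ ≤ 2 * A + 4 * x 0 * |ν 0| / (r ^ 2 + c) * X := by
        refine (norm_add_le _ _).trans ?_
        rw [norm_mul, norm_mul, Real.norm_eq_abs, Real.norm_eq_abs, Real.norm_eq_abs,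
          Real.norm_eq_abs, abs_of_nonneg (by norm_num : (0 : ℝ) ≤ 2),
          abs_of_nonneg (show 0 ≤ 4 * x 0 * t by have := ht.1.le; positivity)]
        -- The factor t from differentiating 4x₁ξ₁t is traded for one power of X. This lowers the
        -- singularity of the second term from r^(-m) to r^(2-m), at the cost of the denominator r²
        -- + c.
        have : t ≤ X / (r ^ 2 + c) := by
          rw [le_div_iff₀ (by positivity), hX]
          nlinarith [ht.2]
        have h3 : 0 ≤ 4 * x 0 * |ν 0| := by positivity
        have h4 := mul_le_mul_of_nonneg_left this h3
        rw [div_mul_eq_mul_div, mul_div_assoc]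
        linarith
      calc _ ≤ t ^ (α - 1) * (1 - t) ^ (α - 1) * (b * X ^ (-(α + (m : ℝ) / 2)) *
            (2 * A + 4 * x 0 * |ν 0| / (r ^ 2 + c) * X)) := by gcongr
        _ = _ := by ring
  have hJ₁' := hJ₁ (r ^ 2) c hR hc0
  have hJ₂' := hJ₂ (r ^ 2) c hR hc0
  have hsq : (ξ 0 + x 0) ^ 2 ≤ r ^ 2 + c := sq_add_le_norm_sub_sq_add ξ x
  set s := √(r ^ 2 + c) with hs
  have hs0 : 0 < s := Real.sqrt_pos.2 (by positivity)
  have hs2 : r ^ 2 + c = s ^ 2 := (Real.sq_sqrt (by positivity)).symm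
  have hsx : ξ 0 + x 0 ≤ s := by
    rw [hs2] at hsq
    exact le_of_sq_le_sq hsq hs0.le
  rw [hs2] at hJ₁' hJ₂' hLb
  have e1 : (r ^ 2) ^ (-((m : ℝ) / 2)) = r ^ (-(m : ℝ)) := by
    rw [← Real.rpow_natCast, ← Real.rpow_mul hr0.le]; congr 1; push_cast; ring
  have e2 : (r ^ 2) ^ (-((m : ℝ) / 2 - 1)) = r ^ (2 - (m : ℝ)) := by
    rw [← Real.rpow_natCast, ← Real.rpow_mul hr0.le]; congr 1; push_cast; ring
  have e3 : (s ^ 2) ^ (-α) = s ^ (-(2 * α)) := by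
    rw [← Real.rpow_natCast, ← Real.rpow_mul hs0.le]; congr 1; push_cast; ring
  -- The weight exactly cancels the factor s^(-2α) common to both integrals.
  have hξs : ξ 0 ^ (2 * α) * s ^ (-(2 * α)) ≤ 1 := by
    rw [Real.rpow_neg hs0.le, ← div_eq_mul_inv, div_le_one (by positivity)]
    exact Real.rpow_le_rpow hξ.le (by linarith) (by linarith)
  have hxs : x 0 / s ^ 2 ≤ 1 / s := by
    rw [div_le_div_iff₀ (by positivity) hs0]; nlinarith
  rw [e1, e3] at hJ₁'
  rw [e2, e3] at hJ₂'
  have hfin : |L ν| ≤ s ^ (-(2 * α)) * (b * (2 * K₁) * (A * r ^ (-(m : ℝ))) +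
      b * (4 * K₂) * (|ν 0| * (r ^ (2 - (m : ℝ)) / s))) := by
    refine hLb.trans ?_
    calc _ ≤ b * (2 * A * (K₁ * (r ^ (-(m : ℝ)) * s ^ (-(2 * α))))) +
          b * (4 * |ν 0| * (x 0 / s ^ 2) * (K₂ * (r ^ (2 - (m : ℝ)) * s ^ (-(2 * α))))) := by
          rw [show 4 * x 0 * |ν 0| / s ^ 2 = 4 * |ν 0| * (x 0 / s ^ 2) by ring]
          gcongr
      _ ≤ b * (2 * A * (K₁ * (r ^ (-(m : ℝ)) * s ^ (-(2 * α))))) +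
          b * (4 * |ν 0| * (1 / s) * (K₂ * (r ^ (2 - (m : ℝ)) * s ^ (-(2 * α))))) := by
          gcongr
      _ = _ := by ring
  rw [hder, abs_mul]
  set P := A * r ^ (-(m : ℝ)) with hP
  set Q := |ν 0| * (r ^ (2 - (m : ℝ)) / s) with hQ
  have hP0 : 0 ≤ P := by positivity
  have hQ0 : 0 ≤ Q := by positivity
  calc ξ 0 ^ (2 * α) * (|C| * |L ν|) ≤ ξ 0 ^ (2 * α) * (|C| * (s ^ (-(2 * α)) *
        (b * (2 * K₁) * P + b * (4 * K₂) * Q))) := by gcongr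
    _ = (ξ 0 ^ (2 * α) * s ^ (-(2 * α))) * (|C| * (b * (2 * K₁) * P + b * (4 * K₂) * Q)) := by ring
    _ ≤ 1 * (|C| * (b * (2 * K₁) * P + b * (4 * K₂) * Q)) := by gcongr
    _ ≤ 1 * (|C| * (b * (2 * K₁ + 4 * K₂) * P + b * (2 * K₁ + 4 * K₂) * Q)) := by
        gcongr <;> linarith
    _ ≤ _ := by
        have : 0 ≤ P + Q := by positivity
        linarith

/-! ### Geometry of the surface and its normals -/

theorem IsOpen.subset_of_disjoint_frontier {X : Type*} [TopologicalSpace X] {Ω J : Set X}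
    (hΩ : IsOpen Ω) (hJ : IsPreconnected J) (hd : Disjoint J (frontier Ω)) :
    ((J ∩ Ω).Nonempty → J ⊆ Ω) ∧ ((J ∩ (closure Ω)ᶜ).Nonempty → J ⊆ (closure Ω)ᶜ) := by
  have hcov : J ⊆ Ω ∪ (closure Ω)ᶜ := fun x hx => by
    by_contra h
    rw [mem_union, not_or, notMem_compl_iff] at h
    refine disjoint_left.1 hd hx ?_
    rw [hΩ.frontier_eq]
    exact ⟨h.2, h.1⟩
  have hdis : Disjoint Ω (closure Ω)ᶜ := disjoint_compl_right.mono_left subset_closure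
  exact ⟨fun h => hJ.subset_left_of_subset_union hΩ isClosed_closure.isOpen_compl hdis hcov h,
    fun h => hJ.subset_right_of_subset_union hΩ isClosed_closure.isOpen_compl hdis hcov h⟩

/-- A chord of the unit sphere is no longer than its arc, by cos θ ≥ 1 - θ²/2. It converts the
Hölder condition on angles into one on normal vectors. -/
theorem norm_sub_le_angle {E : Type*} [NormedAddCommGroup E] [InnerProductSpace ℝ E] {u v : E}
    (hu : ‖u‖ = 1) (hv : ‖v‖ = 1) : ‖u - v‖ ≤ InnerProductGeometry.angle u v := by
  refine le_of_sq_le_sq ?_ (InnerProductGeometry.angle_nonneg u v)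
  have h := InnerProductGeometry.cos_angle_mul_norm_mul_norm u v
  have h2 := Real.one_sub_sq_div_two_le_cos (x := InnerProductGeometry.angle u v)
  rw [hu, hv, mul_one, mul_one] at h
  rw [norm_sub_sq_real, hu, hv, ← h]
  linarith

/-- Taking ε to be half the cosine between d and ν puts both rays strictly inside the cones of the
definition. -/
theorem IsOuterNormal.eventually {m : ℕ} {Ω : Set (EuclideanSpace ℝ (Fin m))}
    {p ν d : EuclideanSpace ℝ (Fin m)} (h : IsOuterNormal Ω p ν) (hd : 0 < ⟪d, ν⟫) :
    ∀ᶠ s : ℝ in 𝓝[>] 0, p + s • d ∉ closure Ω ∧ p - s • d ∈ Ω := by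
  have hd0 : 0 < ‖d‖ := norm_pos_iff.2 fun h0 => by simp [h0] at hd
  have h1 := h.2 (⟪d, ν⟫ / (2 * ‖d‖)) (by positivity)
  have t1 : Tendsto (fun s : ℝ => p + s • d) (𝓝[>] 0) (𝓝 p) := by
    have : Continuous fun s : ℝ => p + s • d := by fun_prop
    simpa using (this.tendsto 0).mono_left nhdsWithin_le_nhds
  have t2 : Tendsto (fun s : ℝ => p - s • d) (𝓝[>] 0) (𝓝 p) := by
    have : Continuous fun s : ℝ => p - s • d := by fun_prop
    simpa using (this.tendsto 0).mono_left nhdsWithin_le_nhds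
  filter_upwards [t1.eventually h1, t2.eventually h1, self_mem_nhdsWithin] with s h2 h3 hs
  have hs : 0 < s := hs
  have e : ⟪d, ν⟫ / (2 * ‖d‖) * (s * ‖d‖) = s * ⟪d, ν⟫ / 2 := by field_simp
  have hpos : 0 < s * ⟪d, ν⟫ := by positivity
  constructor
  · refine h2.2 ?_
    rw [add_sub_cancel_left, norm_smul, Real.norm_of_nonneg hs.le, inner_smul_left, e]
    simp only [conj_trivial]
    linarith
  · refine h3.1 ?_
    rw [sub_sub_cancel_left, norm_neg, norm_smul, Real.norm_of_nonneg hs.le, inner_neg_left,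
      inner_smul_left, neg_mul, e]
    simp only [conj_trivial]
    linarith

section
variable {m : ℕ} [NeZero m] {Ω Γ₁ Γ : Set (EuclideanSpace ℝ (Fin m))}
  {n : EuclideanSpace ℝ (Fin m) → EuclideanSpace ℝ (Fin m)}

theorem continuous_apply_zero : Continuous fun x : EuclideanSpace ℝ (Fin m) => x 0 :=
  (EuclideanSpace.proj (𝕜 := ℝ) 0).continuous

/-- The closure of Γ₁ stays in the hyperplane. Hence any boundary point found at positive height
lies on Γ and has a normal; measurability of Γ also follows. -/
theorem IsDomainBoundedBy.surface_eq (hΩ : IsDomainBoundedBy Ω Γ₁ Γ) :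
    Γ = frontier Ω ∩ {x | 0 < x 0} := by
  have h0 : ∀ x ∈ closure Γ₁, x 0 = 0 := by
    obtain ⟨U, -, hU⟩ := hΩ.base_isOpen
    have hc : IsClosed {x : EuclideanSpace ℝ (Fin m) | x 0 = 0} :=
      isClosed_eq continuous_apply_zero continuous_const
    exact fun x hx => closure_minimal (hU ▸ inter_subset_right) hc hx
  rw [hΩ.frontier_eq]
  ext x
  constructor
  · exact fun hx => ⟨Or.inr hx, hΩ.surface_pos x hx⟩
  · rintro ⟨hx | hx, hx0⟩
    · exact absurd (h0 x hx) (ne_of_gt hx0)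
    · exact hx

theorem IsDomainBoundedBy.measurableSet_surface (hΩ : IsDomainBoundedBy Ω Γ₁ Γ) :
    MeasurableSet Γ := by
  rw [hΩ.surface_eq]
  exact isClosed_frontier.measurableSet.inter
    (isOpen_lt continuous_const continuous_apply_zero).measurableSet

theorem IsDomainBoundedBy.isBounded_surface (hΩ : IsDomainBoundedBy Ω Γ₁ Γ) :
    Bornology.IsBounded Γ := by
  refine hΩ.isBounded.closure.subset ?_
  rw [hΩ.surface_eq]
  exact inter_subset_left.trans frontier_subset_closure

/-- A segment between two points of the surface cannot cross the surface outwards only. -/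
theorem exists_inner_normal_nonpos (hΩ : IsDomainBoundedBy Ω Γ₁ Γ)
    (hn : ∀ ξ ∈ Γ, IsOuterNormal Ω ξ (n ξ)) {ξ η : EuclideanSpace ℝ (Fin m)} (hξ : ξ ∈ Γ)
    (hη : η ∈ Γ) : ∃ ζ ∈ Γ, dist ζ ξ ≤ dist η ξ ∧ dist ζ η ≤ dist η ξ ∧ ⟪η - ξ, n ζ⟫ ≤ 0 := by
  by_contra! hcon
  set d := η - ξ with hd
  have hp : Continuous fun t : ℝ => ξ + t • d := by fun_prop
  have hd1 : ∀ t ∈ Icc (0 : ℝ) 1, dist (ξ + t • d) ξ ≤ dist η ξ := fun t ht => by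
    rw [dist_eq_norm, dist_eq_norm, add_sub_cancel_left, norm_smul, Real.norm_of_nonneg ht.1]
    exact mul_le_of_le_one_left (norm_nonneg _) ht.2
  have hd2 : ∀ t ∈ Icc (0 : ℝ) 1, dist (ξ + t • d) η ≤ dist η ξ := fun t ht => by
    rw [dist_eq_norm, dist_eq_norm, show ξ + t • d - η = -((1 - t) • d) by rw [hd]; module,
      norm_neg, norm_smul, Real.norm_of_nonneg (by linarith [ht.2])]
    exact mul_le_of_le_one_left (norm_nonneg _) (by linarith [ht.1])
  have hdξ : 0 < ⟪d, n ξ⟫ := hcon ξ hξ (by simp) (by rw [dist_comm])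
  obtain ⟨δ, ⟨hδ, -⟩, hδ0, hδ1⟩ := (((hn ξ hξ).eventually hdξ).and
    (Ioo_mem_nhdsGT (zero_lt_one (α := ℝ)))).exists
  have hK : IsCompact (Icc δ 1 ∩ (fun t : ℝ => ξ + t • d) ⁻¹' closure Ω) :=
    isCompact_Icc.inter_right (isClosed_closure.preimage hp)
  have hη' : η ∈ closure Ω := by
    rw [hΩ.surface_eq] at hη
    exact frontier_subset_closure hη.1
  -- The segment has left the closure of Ω by parameter δ; t is its first return. That point lies on
  -- Γ and is approached from outside, whereas a normal with positive product with d would force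
  -- points of Ω just before it.
  obtain ⟨t, ⟨ht1, ht2⟩, htl⟩ := hK.exists_isLeast ⟨1, ⟨hδ1.le, le_rfl⟩, by simpa [hd] using hη'⟩
  have htδ : δ < t := lt_of_le_of_ne ht1.1 (by rintro rfl; exact hδ ht2)
  have ht01 : t ∈ Icc (0 : ℝ) 1 := ⟨hδ0.le.trans ht1.1, ht1.2⟩
  have hleft : ∀ s ∈ Ioo δ t, ξ + s • d ∉ closure Ω := fun s hs h =>
    absurd (htl ⟨⟨hs.1.le, hs.2.le.trans ht1.2⟩, h⟩) (not_le.2 hs.2)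
  have hev : ∀ᶠ s in 𝓝[<] t, s ∈ Ioo δ t := Ioo_mem_nhdsLT htδ
  have hΓ : ξ + t • d ∈ Γ := by
    rw [hΩ.surface_eq]
    refine ⟨?_, ?_⟩
    · rw [hΩ.isOpen.frontier_eq]
      refine ⟨ht2, fun hmem => ?_⟩
      have h1 : ∀ᶠ s in 𝓝[<] t, ξ + s • d ∈ Ω :=
        ((hp.tendsto t).mono_left nhdsWithin_le_nhds).eventually (hΩ.isOpen.mem_nhds hmem)
      obtain ⟨s, hs1, hs2⟩ := (h1.and hev).exists
      exact hleft s hs2 (subset_closure hs1)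
    · have h1 := hΩ.surface_pos ξ hξ
      have h2 := hΩ.surface_pos η hη
      change 0 < ξ 0 + t * (η 0 - ξ 0)
      nlinarith [ht01.1, ht01.2, mul_nonneg ht01.1 h2.le]
  have h3 := (hn _ hΓ).eventually (hcon _ hΓ (hd1 t ht01) (hd2 t ht01))
  obtain ⟨s, ⟨-, hs1⟩, hs2, hs3⟩ := (h3.and (Ioo_mem_nhdsGT (sub_pos.2 htδ))).exists
  refine hleft (t - s) ⟨by linarith, by linarith⟩ (subset_closure ?_)
  convert hs1 using 1
  module

/-- The Lyapunov inequality for the angle between a chord and a normal. -/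
theorem abs_inner_sub_normal_le (hΩ : IsDomainBoundedBy Ω Γ₁ Γ)
    (hn : ∀ ξ ∈ Γ, IsOuterNormal Ω ξ (n ξ)) {a β : ℝ} (ha : 0 ≤ a) (hβ : 0 < β)
    (hH : ∀ x ∈ Γ, ∀ ξ ∈ Γ, ‖n x - n ξ‖ ≤ a * dist x ξ ^ β)
    {ξ η : EuclideanSpace ℝ (Fin m)} (hξ : ξ ∈ Γ) (hη : η ∈ Γ) :
    |⟪η - ξ, n ξ⟫| ≤ a * dist η ξ ^ β * dist η ξ := by
  have key : ∀ v : EuclideanSpace ℝ (Fin m), ‖v‖ = dist η ξ → ∀ ζ ∈ Γ, dist ζ ξ ≤ dist η ξ →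
      ⟪v, n ζ⟫ ≤ 0 → ⟪v, n ξ⟫ ≤ a * dist η ξ ^ β * dist η ξ := by
    intro v hv ζ hζ hd h0
    have h1 : ⟪v, n ξ⟫ = ⟪v, n ζ⟫ + ⟪v, n ξ - n ζ⟫ := by rw [inner_sub_right]; ring
    have h2 := real_inner_le_norm v (n ξ - n ζ)
    have h3 : ‖n ξ - n ζ‖ ≤ a * dist η ξ ^ β := by
      rw [norm_sub_rev]
      exact (hH ζ hζ ξ hξ).trans (by gcongr)
    have h4 := mul_le_mul_of_nonneg_left h3 (norm_nonneg v)
    rw [hv] at h4 h2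
    linarith
  rw [abs_le']
  -- The two orientations of the segment give the two signs. In each case the Hölder condition
  -- transfers the sign at the intermediate point to ξ, with the stated error.
  obtain ⟨ζ, hζ, h1, h2, h3⟩ := exists_inner_normal_nonpos hΩ hn hξ hη
  obtain ⟨ζ', hζ', h1', h2', h3'⟩ := exists_inner_normal_nonpos hΩ hn hη hξ
  refine ⟨key _ (dist_eq_norm η ξ).symm ζ hζ h1 h3, ?_⟩
  rw [← inner_neg_left, neg_sub]
  exact key _ (by rw [dist_comm, dist_eq_norm]) ζ' hζ' (by rwa [dist_comm ξ η] at h2') h3'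

theorem IsLyapunovSurface.exists_norm_sub_le (hΓ : IsLyapunovSurface Ω Γ n) :
    ∃ a β : ℝ, 0 < a ∧ 0 < β ∧ β ≤ 1 ∧ ∀ x ∈ Γ, ∀ ξ ∈ Γ, ‖n x - n ξ‖ ≤ a * dist x ξ ^ β := by
  obtain ⟨a, β, ha, hβ, h⟩ := hΓ.holder
  -- At distances above 1 the trivial bound 2 between unit vectors suffices, so the exponent may be
  -- capped at 1.
  refine ⟨a + 2, min β 1, by linarith, lt_min hβ one_pos, min_le_right _ _, fun x hx ξ hξ => ?_⟩
  have hx1 := (hΓ.normal x hx).1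
  have hξ1 := (hΓ.normal ξ hξ).1
  rcases le_or_gt (dist x ξ) 1 with hd | hd
  · refine (norm_sub_le_angle hx1 hξ1).trans ((h x hx ξ hξ).trans ?_)
    have h1 : dist x ξ ^ β ≤ dist x ξ ^ min β 1 :=
      Real.rpow_le_rpow_of_exponent_ge' dist_nonneg hd (lt_min hβ one_pos).le (min_le_left _ _)
    have : 0 ≤ dist x ξ ^ min β 1 := by positivity
    nlinarith
  · have h1 : 1 ≤ dist x ξ ^ min β 1 := Real.one_le_rpow hd.le (lt_min hβ one_pos).le
    have h2 := norm_sub_le (n x) (n ξ)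
    rw [hx1, hξ1] at h2
    nlinarith

/-- Compactness of the closure of Γ makes the right angle condition uniform: a sequence of
counterexamples of height tending to zero would accumulate at an edge point. -/
theorem IsLyapunovSurface.exists_abs_normal_zero_lt (hΩ : IsDomainBoundedBy Ω Γ₁ Γ)
    (hΓ : IsLyapunovSurface Ω Γ n) {ε : ℝ} (hε : 0 < ε) :
    ∃ h : ℝ, 0 < h ∧ ∀ ξ ∈ Γ, ξ 0 < h → |n ξ 0| < ε := by
  by_contra! hcon
  choose! u hu using fun k : ℕ => hcon (1 / ((k : ℝ) + 1)) (by positivity)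
  obtain ⟨p, hp, φ', hφ, hlim⟩ := hΩ.isBounded_surface.isCompact_closure.tendsto_subseq
    (x := u) fun k => subset_closure (hu k).1
  have h0 : Tendsto (fun k => u k 0) atTop (𝓝 0) :=
    squeeze_zero (fun k => (hΩ.surface_pos _ (hu k).1).le) (fun k => (hu k).2.1.le)
      tendsto_one_div_add_atTop_nhds_zero_nat
  have hp0 : p 0 = 0 := tendsto_nhds_unique
    ((continuous_apply_zero.tendsto p).comp hlim) (h0.comp hφ.tendsto_atTop)
  have hlim' : Tendsto (u ∘ φ') atTop (𝓝[Γ] p) :=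
    tendsto_nhdsWithin_iff.2 ⟨hlim, Eventually.of_forall fun k => (hu _).1⟩
  have h1 := ((hΓ.right_angle p hp hp0).comp hlim').abs
  rw [abs_zero] at h1
  exact absurd (ge_of_tendsto' h1 fun k => (hu (φ' k)).2.2) (not_le.2 hε)
/-- If the rays from `ξ ∈ Γ` in two directions that descend towards the hyperplane `x₁ = 0`, one
inwards and one outwards, do not meet `Γ`, then `Γ` has points near `ξ` at all lower heights. -/
theorem exists_mem_surface_of_rays (hΩ : IsDomainBoundedBy Ω Γ₁ Γ)
    {ξ ν d₁ d₂ : EuclideanSpace ℝ (Fin m)} (hξ : ξ ∈ Γ) (hν : IsOuterNormal Ω ξ ν)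
    (h1 : ⟪d₁, ν⟫ < 0) (h2 : 0 < ⟪d₂, ν⟫) (hd1 : d₁ 0 = -1) (hd2 : d₂ 0 = -1)
    (hr1 : ∀ s ∈ Ioo 0 (ξ 0), ξ + s • d₁ ∉ Γ) (hr2 : ∀ s ∈ Ioo 0 (ξ 0), ξ + s • d₂ ∉ Γ)
    {s : ℝ} (hs : s ∈ Ioo 0 (ξ 0)) :
    ∃ ζ ∈ segment ℝ (ξ + s • d₁) (ξ + s • d₂), ζ ∈ Γ ∧ ζ 0 = ξ 0 - s := by
  have hξ0 : 0 < ξ 0 := hΩ.surface_pos ξ hξ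
  have hpre : ∀ d : EuclideanSpace ℝ (Fin m),
      IsPreconnected ((fun s : ℝ => ξ + s • d) '' Ioo 0 (ξ 0)) := fun d =>
    isPreconnected_Ioo.image _ (by fun_prop : Continuous fun s : ℝ => ξ + s • d).continuousOn
  have hdis : ∀ d : EuclideanSpace ℝ (Fin m), d 0 = -1 → (∀ s ∈ Ioo 0 (ξ 0), ξ + s • d ∉ Γ) →
      Disjoint ((fun s : ℝ => ξ + s • d) '' Ioo 0 (ξ 0)) (frontier Ω) := by
    intro d hd hr
    rw [disjoint_left]
    rintro _ ⟨s, hs, rfl⟩ hf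
    refine hr s hs ?_
    rw [hΩ.surface_eq]
    refine ⟨hf, ?_⟩
    change 0 < ξ 0 + s * d 0
    rw [hd]; linarith [hs.2]
  have hin : ξ + s • d₁ ∈ Ω := by
    obtain ⟨t, ⟨-, ht⟩, ht'⟩ := ((hν.eventually (d := -d₁) (by rw [inner_neg_left]; linarith)).and
      (Ioo_mem_nhdsGT hξ0)).exists
    refine (hΩ.isOpen.subset_of_disjoint_frontier (hpre d₁) (hdis d₁ hd1 hr1)).1
      ⟨_, ⟨t, ht', rfl⟩, ?_⟩ ⟨s, hs, rfl⟩
    simpa using ht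
  have hout : ξ + s • d₂ ∈ (closure Ω)ᶜ := by
    obtain ⟨t, ⟨ht, -⟩, ht'⟩ := ((hν.eventually h2).and (Ioo_mem_nhdsGT hξ0)).exists
    exact (hΩ.isOpen.subset_of_disjoint_frontier (hpre d₂) (hdis d₂ hd2 hr2)).2
      ⟨_, ⟨t, ht', rfl⟩, ht⟩ ⟨s, hs, rfl⟩
  -- One ray stays in Ω and the other outside its closure, so the horizontal segment joining them at
  -- this height meets the boundary.
  obtain ⟨ζ, hζ, hζf⟩ : ∃ ζ ∈ segment ℝ (ξ + s • d₁) (ξ + s • d₂), ζ ∈ frontier Ω := by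
    by_contra! hcon
    have := (hΩ.isOpen.subset_of_disjoint_frontier (convex_segment _ _).isPreconnected
      (disjoint_left.2 hcon)).1 ⟨_, left_mem_segment ℝ _ _, hin⟩ (right_mem_segment ℝ _ _)
    exact hout (subset_closure this)
  have hζ0 : ζ 0 = ξ 0 - s := by
    obtain ⟨a, b, ha, hb, hab, rfl⟩ := hζ
    change a * (ξ 0 + s * d₁ 0) + b * (ξ 0 + s * d₂ 0) = _
    rw [hd1, hd2]
    linear_combination (ξ 0 - s) * hab
  refine ⟨ζ, hζ, ?_, hζ0⟩
  rw [hΩ.surface_eq]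
  refine ⟨hζf, ?_⟩
  change 0 < ζ 0
  rw [hζ0]; linarith [hs.2]

/-- The cosine of the angle between the normal and the `x₁`-axis is Hölder small near the
hyperplane `x₁ = 0`. -/
theorem IsLyapunovSurface.exists_abs_normal_zero_le (hΩ : IsDomainBoundedBy Ω Γ₁ Γ)
    (hΓ : IsLyapunovSurface Ω Γ n) {a β : ℝ} (ha : 0 < a) (hβ : 0 < β)
    (hH : ∀ x ∈ Γ, ∀ ξ ∈ Γ, ‖n x - n ξ‖ ≤ a * dist x ξ ^ β) :
    ∃ M : ℝ, 0 < M ∧ ∀ ξ ∈ Γ, |n ξ 0| ≤ M * ξ 0 ^ β := by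
  obtain ⟨h₁, hh₁, hsmall⟩ := hΓ.exists_abs_normal_zero_lt hΩ (ε := 1 / 4) (by norm_num)
  obtain ⟨h₂, hh₂, hray⟩ : ∃ h : ℝ, 0 < h ∧ ∀ s : ℝ, 0 < s → s < h →
      2 * (a * (2 * s) ^ β) < 1 / 8 := by
    have hc : ContinuousAt (fun s : ℝ => 2 * (a * (2 * s) ^ β)) 0 :=
      continuousAt_const.mul (continuousAt_const.mul
        (ContinuousAt.rpow_const (f := fun s : ℝ => 2 * s) (by fun_prop) (Or.inr hβ.le)))
    have h0 : (fun s : ℝ => 2 * (a * (2 * s) ^ β)) 0 < 1 / 8 := by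
      simp [Real.zero_rpow hβ.ne']
    obtain ⟨h, hh, hb⟩ := Metric.eventually_nhds_iff.1 (hc.eventually_lt_const h0)
    exact ⟨h, hh, fun s hs hsh => hb (by simpa [abs_of_pos hs] using hsh)⟩
  set h := min h₁ h₂ with hh
  have hh0 : 0 < h := lt_min hh₁ hh₂
  -- The second summand handles heights at least h, where |n₁| ≤ 1 is enough; the first handles
  -- heights below h.
  refine ⟨a * 2 ^ β + h ^ (-β), by positivity, fun ξ hξ => ?_⟩
  have hξ0 : 0 < ξ 0 := hΩ.surface_pos ξ hξ
  have hn1 : ‖n ξ‖ = 1 := (hΓ.normal ξ hξ).1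
  have hn01 : |n ξ 0| ≤ 1 := hn1 ▸ PiLp.norm_apply_le (n ξ) 0
  have hpβ : 0 < ξ 0 ^ β := by positivity
  rcases le_or_gt h (ξ 0) with hhξ | hhξ
  · have h1 : 1 ≤ h ^ (-β) * ξ 0 ^ β := by
      rw [Real.rpow_neg hh0.le, inv_mul_eq_div, one_le_div (by positivity)]
      exact Real.rpow_le_rpow hh0.le hhξ hβ.le
    have : 0 ≤ a * 2 ^ β * ξ 0 ^ β := by positivity
    rw [add_mul]
    linarith
  have hν0 : |n ξ 0| < 1 / 4 := hsmall ξ hξ (hhξ.trans_le (min_le_left _ _))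
  obtain ⟨hν1, hν2⟩ := abs_lt.1 hν0
  set e : EuclideanSpace ℝ (Fin m) := EuclideanSpace.single 0 1 with he
  have he1 : ‖e‖ = 1 := by simp [he]
  have he0 : e 0 = 1 := by simp [he]
  have hen : ⟪e, n ξ⟫ = n ξ 0 := by simp [he, EuclideanSpace.inner_single_left]
  -- Descend at unit speed while moving along the horizontal part of the normal. For τ = ±1/2 and
  -- |n₁| < 1/4 the products with the normal have opposite signs and modulus at least 1/8.
  set d : ℝ → EuclideanSpace ℝ (Fin m) := fun τ => -e + τ • (n ξ - n ξ 0 • e) with hd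
  have hd0 : ∀ τ, d τ 0 = -1 := fun τ => by
    change -(e 0) + τ * (n ξ 0 - n ξ 0 * e 0) = -1
    rw [he0]; ring
  have hdn : ∀ τ, ⟪d τ, n ξ⟫ = -n ξ 0 + τ * (1 - n ξ 0 ^ 2) := fun τ => by
    rw [hd]
    simp only [inner_add_left, inner_neg_left, inner_smul_left, inner_sub_left, hen,
      real_inner_self_eq_norm_sq, hn1, conj_trivial]
    ring
  have hdnorm : ∀ τ, |τ| = 1 / 2 → ‖d τ‖ ≤ 2 := fun τ hτ => by
    have h1 : ‖n ξ - n ξ 0 • e‖ ≤ 2 := by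
      refine (norm_sub_le _ _).trans ?_
      rw [norm_smul, he1, hn1, Real.norm_eq_abs]
      linarith
    refine (norm_add_le _ _).trans ?_
    rw [norm_neg, norm_smul, he1, Real.norm_eq_abs, hτ]
    linarith
  have hsq : n ξ 0 ^ 2 ≤ 1 / 16 := by nlinarith
  -- A hit at parameter s would be a chord with normal component at least s/8, while the Lyapunov
  -- inequality and the choice of h₂ make it smaller.
  have hrays : ∀ τ, |τ| = 1 / 2 → 1 / 8 ≤ |⟪d τ, n ξ⟫| → ∀ s ∈ Ioo 0 (ξ 0), ξ + s • d τ ∉ Γ := by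
    intro τ hτ hτn s hs hmem
    have h1 := abs_inner_sub_normal_le hΩ hΓ.normal ha.le hβ hH hξ hmem
    rw [add_sub_cancel_left, inner_smul_left, dist_eq_norm, add_sub_cancel_left, norm_smul,
      Real.norm_of_nonneg hs.1.le, conj_trivial, abs_mul, abs_of_pos hs.1] at h1
    have h2 := hray s hs.1 (hs.2.trans (hhξ.trans_le (min_le_right _ _)))
    have h3 : s * ‖d τ‖ ≤ 2 * s := by nlinarith [hdnorm τ hτ, hs.1]
    have h4 : a * (s * ‖d τ‖) ^ β * (s * ‖d τ‖) ≤ a * (2 * s) ^ β * (2 * s) := by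
      have := hs.1.le
      gcongr
    have h5 := mul_le_mul_of_nonneg_left hτn hs.1.le
    nlinarith [mul_lt_mul_of_pos_left h2 hs.1]
  have hneg : ⟪d (-(1 / 2)), n ξ⟫ ≤ -(1 / 8) := by rw [hdn]; linarith
  have hpos : 1 / 8 ≤ ⟪d (1 / 2), n ξ⟫ := by rw [hdn]; linarith
  have hlow : ∀ s ∈ Ioo 0 (ξ 0), ∃ ζ ∈ Γ, ζ 0 = ξ 0 - s ∧ dist ξ ζ ≤ 2 * ξ 0 := by
    intro s hs
    have hτ1 : |(-(1 / 2) : ℝ)| = 1 / 2 := by rw [abs_neg, abs_of_pos (by norm_num)]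
    have hτ2 : |(1 / 2 : ℝ)| = 1 / 2 := abs_of_pos (by norm_num)
    obtain ⟨ζ, hζ, hζΓ, hζ0⟩ := exists_mem_surface_of_rays hΩ hξ (hΓ.normal ξ hξ)
      (d₁ := d (-(1 / 2))) (d₂ := d (1 / 2)) (by linarith) (by linarith) (hd0 _) (hd0 _)
      (hrays _ hτ1 (by rw [abs_of_neg (by linarith)]; linarith))
      (hrays _ hτ2 (by rw [abs_of_pos (by linarith)]; exact hpos)) hs
    refine ⟨ζ, hζΓ, hζ0, ?_⟩
    have hball : ∀ τ, |τ| = 1 / 2 → ξ + s • d τ ∈ Metric.closedBall ξ (2 * ξ 0) := fun τ hτ => by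
      rw [Metric.mem_closedBall, dist_eq_norm, add_sub_cancel_left, norm_smul,
        Real.norm_of_nonneg hs.1.le]
      nlinarith [hdnorm τ hτ, hs.1, hs.2]
    have := (convex_closedBall ξ (2 * ξ 0)).segment_subset (hball _ hτ1) (hball _ hτ2) hζ
    rwa [dist_comm]
  have hmain : |n ξ 0| ≤ a * (2 * ξ 0) ^ β := by
    refine le_of_forall_pos_le_add fun ε hε => ?_
    obtain ⟨h₃, hh₃, hs₃⟩ := hΓ.exists_abs_normal_zero_lt hΩ hε
    have hmin : 0 < min h₃ (ξ 0) := lt_min hh₃ hξ0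
    have hm1 := min_le_left h₃ (ξ 0)
    have hm2 := min_le_right h₃ (ξ 0)
    -- This ζ is so low that |n₁| < ε there, yet within 2ξ₁ of ξ; the Hölder condition then gives
    -- the rate.
    obtain ⟨ζ, hζ, hζ0, hζd⟩ := hlow (ξ 0 - min h₃ (ξ 0) / 2) ⟨by linarith, by linarith⟩
    have h1 := hs₃ ζ hζ (by rw [hζ0]; linarith)
    have h2 : |(n ξ - n ζ) 0| ≤ ‖n ξ - n ζ‖ := PiLp.norm_apply_le (n ξ - n ζ) 0
    have h3 : a * dist ξ ζ ^ β ≤ a * (2 * ξ 0) ^ β := by gcongr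
    have h4 := hH ξ hξ ζ hζ
    rw [PiLp.sub_apply] at h2
    have h5 := abs_add_le (n ξ 0 - n ζ 0) (n ζ 0)
    rw [sub_add_cancel] at h5
    linarith
  rw [Real.mul_rpow (by norm_num) hξ0.le, ← mul_assoc] at hmain
  have : 0 ≤ h ^ (-β) * ξ 0 ^ β := by positivity
  rw [add_mul]
  linarith
end

/-! ### Growth of the surface measure -/

theorem euclideanHausdorffMeasure_image_le {X Y : Type*} [EMetricSpace X] [EMetricSpace Y]
    [MeasurableSpace X] [BorelSpace X] [MeasurableSpace Y] [BorelSpace Y] {K : NNReal} {f : X → Y}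
    {s : Set X} (h : LipschitzOnWith K f s) (d : ℕ) :
    Measure.euclideanHausdorffMeasure d (f '' s) ≤
      (K : ENNReal) ^ d * Measure.euclideanHausdorffMeasure d s := by
  have h1 := h.hausdorffMeasure_image_le (Nat.cast_nonneg (α := ℝ) d)
  rw [ENNReal.rpow_natCast] at h1
  simp only [Measure.euclideanHausdorffMeasure_def, Measure.smul_apply, ENNReal.smul_def,
    smul_eq_mul]
  rw [mul_left_comm]
  gcongr

/-- A subset of a ball whose chords make a small angle with a hyperplane has controlled measure. -/
theorem euclideanHausdorffMeasure_le_of_abs_inner_le {m : ℕ} (hm : 0 < m)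
    {S : Set (EuclideanSpace ℝ (Fin m))} {y ν : EuclideanSpace ℝ (Fin m)} {ρ : ℝ} (hρ : 0 ≤ ρ)
    (hν : ‖ν‖ = 1) (hS : S ⊆ Metric.closedBall y ρ)
    (hc : ∀ ξ ∈ S, ∀ η ∈ S, |⟪η - ξ, ν⟫| ≤ 1 / 2 * dist η ξ) :
    Measure.euclideanHausdorffMeasure (m - 1) S ≤ ENNReal.ofReal (ρ ^ (m - 1)) *
      (2 ^ (m - 1) * volume (Metric.ball (0 : EuclideanSpace ℝ (Fin (m - 1))) 1)) := by
  have : Fact (Module.finrank ℝ (EuclideanSpace ℝ (Fin m)) = m - 1 + 1) :=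
    ⟨by rw [finrank_euclideanSpace_fin]; omega⟩
  have hν0 : ν ≠ 0 := by rintro rfl; simp at hν
  set e := (OrthonormalBasis.fromOrthogonalSpanSingleton (𝕜 := ℝ) (m - 1) hν0).repr with he
  set π' : EuclideanSpace ℝ (Fin m) → EuclideanSpace ℝ (Fin (m - 1)) := fun v =>
    e ((ℝ ∙ ν)ᗮ.orthogonalProjectionOnto v) with hπ
  have hsub : ∀ u v, π' u - π' v = π' (u - v) := fun u v => by simp [hπ]
  have hnorm : ∀ v, ‖v‖ ^ 2 = ⟪v, ν⟫ ^ 2 + ‖π' v‖ ^ 2 := fun v => by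
    rw [Submodule.norm_sq_eq_add_norm_sq_projection v (ℝ ∙ ν)]
    congr 1
    · rw [← Submodule.norm_coe, ← Submodule.starProjection_apply,
        Submodule.starProjection_unit_singleton ℝ hν, norm_smul, hν, mul_one, Real.norm_eq_abs,
        sq_abs, real_inner_comm]
    · simp only [hπ, LinearIsometryEquiv.norm_map]
  have hle : ∀ v, ‖π' v‖ ≤ ‖v‖ := fun v => by
    refine le_of_sq_le_sq ?_ (norm_nonneg _)
    rw [hnorm v]; nlinarith
  -- By Pythagoras at least 3/4 of the squared length of a chord survives the projection. So S is a
  -- 2-Lipschitz image of a subset of a ball of the same radius in dimension m - 1.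
  have hge : ∀ ξ ∈ S, ∀ η ∈ S, dist η ξ ≤ 2 * dist (π' η) (π' ξ) := fun ξ hξ η hη => by
    have h1 := hc ξ hξ η hη
    rw [dist_eq_norm] at h1 ⊢
    rw [dist_eq_norm, hsub]
    have h2 := hnorm (η - ξ)
    have h3 : ⟪η - ξ, ν⟫ ^ 2 ≤ (1 / 2 * ‖η - ξ‖) ^ 2 := sq_le_sq' (abs_le.1 h1).1 (abs_le.1 h1).2
    refine le_of_sq_le_sq ?_ (by positivity)
    nlinarith
  have hinj : InjOn π' S := fun η hη ξ hξ h => by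
    have := hge ξ hξ η hη
    rw [h, dist_self, mul_zero] at this
    exact dist_le_zero.1 this
  have hLip : LipschitzOnWith 2 (Function.invFunOn π' S) (π' '' S) := by
    refine LipschitzOnWith.of_dist_le_mul ?_
    rintro _ ⟨η, hη, rfl⟩ _ ⟨ξ, hξ, rfl⟩
    rw [hinj.leftInvOn_invFunOn hη, hinj.leftInvOn_invFunOn hξ]
    exact hge ξ hξ η hη
  have hSeq : Function.invFunOn π' S '' (π' '' S) = S := hinj.leftInvOn_invFunOn.image_image
  have h1 := euclideanHausdorffMeasure_image_le hLip (m - 1)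
  rw [hSeq, EuclideanSpace.euclideanHausdorffMeasure_eq_volume] at h1
  have h2 : π' '' S ⊆ Metric.closedBall (π' y) ρ := by
    rintro _ ⟨η, hη, rfl⟩
    rw [Metric.mem_closedBall, dist_eq_norm, hsub]
    have := hS hη
    rw [Metric.mem_closedBall, dist_eq_norm] at this
    exact (hle _).trans this
  have h3 := measure_mono (μ := volume) h2
  rw [Measure.addHaar_closedBall _ _ hρ, finrank_euclideanSpace_fin] at h3
  refine h1.trans ((mul_le_mul_right h3 _).trans (le_of_eq ?_))
  rw [mul_left_comm]; rfl

/-- The surface measure is upper Ahlfors regular of dimension `m - 1`. -/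
theorem exists_euclideanHausdorffMeasure_inter_closedBall_le {m : ℕ} [NeZero m] {a β : ℝ}
    {Γ : Set (EuclideanSpace ℝ (Fin m))} {n : EuclideanSpace ℝ (Fin m) → EuclideanSpace ℝ (Fin m)}
    (hb : Bornology.IsBounded Γ) (hn : ∀ ξ ∈ Γ, ‖n ξ‖ = 1) (ha : 0 < a) (hβ : 0 < β)
    (hH : ∀ x ∈ Γ, ∀ ξ ∈ Γ, ‖n x - n ξ‖ ≤ a * dist x ξ ^ β)
    (hL : ∀ ξ ∈ Γ, ∀ η ∈ Γ, |⟪η - ξ, n ξ⟫| ≤ a * dist η ξ ^ β * dist η ξ) :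
    ∃ C : ℝ, 0 < C ∧ ∀ (y : EuclideanSpace ℝ (Fin m)) (ρ : ℝ), 0 < ρ →
      Measure.euclideanHausdorffMeasure (m - 1) (Γ ∩ Metric.closedBall y ρ) ≤
        ENNReal.ofReal (C * ρ ^ (m - 1)) := by
  have hm : 0 < m := Nat.pos_of_ne_zero (NeZero.ne m)
  -- Within a ball of radius δ, chords deviate by at most 1/4 from the tangent plane at their own
  -- endpoint, and normals differ by at most 1/4. Together this is the slope 1/2 with respect to one
  -- fixed normal.
  obtain ⟨δ, hδ0, hδ⟩ : ∃ δ : ℝ, 0 < δ ∧ a * (2 * δ) ^ β < 1 / 4 := by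
    have hc : ContinuousAt (fun s : ℝ => a * (2 * s) ^ β) 0 := continuousAt_const.mul
        (ContinuousAt.rpow_const (f := fun s : ℝ => 2 * s) (by fun_prop) (Or.inr hβ.le))
    have h0 : (fun s : ℝ => a * (2 * s) ^ β) 0 < 1 / 4 := by
      simp [Real.zero_rpow hβ.ne']
    have h1 := (hc.eventually_lt_const h0).filter_mono (nhdsWithin_le_nhds (s := Ioi 0))
    obtain ⟨δ, h2, h3⟩ := (h1.and self_mem_nhdsWithin).exists
    exact ⟨δ, h3, h2⟩
  set V : ENNReal := 2 ^ (m - 1) * volume (Metric.ball (0 : EuclideanSpace ℝ (Fin (m - 1))) 1)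
    with hV
  have hVtop : V ≠ ⊤ := ENNReal.mul_ne_top (by simp) measure_ball_lt_top.ne
  have hsmall : ∀ (y : EuclideanSpace ℝ (Fin m)) (ρ : ℝ), 0 < ρ → ρ ≤ δ →
      Measure.euclideanHausdorffMeasure (m - 1) (Γ ∩ Metric.closedBall y ρ) ≤
        ENNReal.ofReal (ρ ^ (m - 1)) * V := by
    intro y ρ hρ hρδ
    rcases (Γ ∩ Metric.closedBall y ρ).eq_empty_or_nonempty with he | ⟨p, hp, hpy⟩
    · rw [he, measure_empty]; exact zero_le
    have hd : ∀ ξ ∈ Metric.closedBall y ρ, ∀ η ∈ Metric.closedBall y ρ, dist η ξ ≤ 2 * δ := by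
      intro ξ hξ η hη
      have := dist_triangle_right η ξ y
      have := Metric.mem_closedBall.1 hξ
      have := Metric.mem_closedBall.1 hη
      linarith
    refine euclideanHausdorffMeasure_le_of_abs_inner_le hm hρ.le (hn p hp) inter_subset_right ?_
    rintro ξ ⟨hξ, hξy⟩ η ⟨hη, hηy⟩
    have h1 := hL ξ hξ η hη
    have h2 := hH p hp ξ hξ
    have h3 : a * dist η ξ ^ β ≤ 1 / 4 := by
      refine le_trans ?_ hδ.le
      have := hd ξ hξy η hηy
      gcongr
    have h4 : ‖n p - n ξ‖ ≤ 1 / 4 := by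
      refine h2.trans (le_trans ?_ hδ.le)
      have := hd ξ hξy p hpy
      gcongr
    have h5 : ⟪η - ξ, n p⟫ = ⟪η - ξ, n ξ⟫ + ⟪η - ξ, n p - n ξ⟫ := by rw [inner_sub_right]; ring
    have h6 := abs_real_inner_le_norm (η - ξ) (n p - n ξ)
    rw [← dist_eq_norm η ξ] at h6
    have h7 := mul_le_mul_of_nonneg_left h4 (dist_nonneg (x := η) (y := ξ))
    have h8 := mul_le_mul_of_nonneg_right h3 (dist_nonneg (x := η) (y := ξ))
    rw [h5]
    refine (abs_add_le _ _).trans ?_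
    linarith
  obtain ⟨t, ht, htΓ⟩ := Metric.totallyBounded_iff.1
    (hb.isCompact_closure.totallyBounded.subset subset_closure) δ hδ0
  have hfin : Measure.euclideanHausdorffMeasure (m - 1) Γ ≠ ⊤ := by
    have hcov : Γ ⊆ ⋃ y ∈ t, Γ ∩ Metric.closedBall y δ := fun ξ hξ => by
      obtain ⟨y, hy, hξy⟩ := mem_iUnion₂.1 (htΓ hξ)
      exact mem_iUnion₂.2 ⟨y, hy, hξ, Metric.ball_subset_closedBall hξy⟩
    refine ((measure_mono hcov).trans_lt ((measure_biUnion_lt_top ht fun y _ => ?_))).ne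
    exact (hsmall y δ hδ0 le_rfl).trans_lt
      (ENNReal.mul_ne_top ENNReal.ofReal_ne_top hVtop).lt_top
  set M := (Measure.euclideanHausdorffMeasure (m - 1) Γ).toReal with hM
  -- The first term serves radii up to δ, the second bounds larger balls by the total mass, and the
  -- 1 ensures positivity.
  refine ⟨V.toReal + M / δ ^ (m - 1) + 1, by positivity, fun y ρ hρ => ?_⟩
  rcases le_or_gt ρ δ with h | h
  · refine (hsmall y ρ hρ h).trans ?_
    rw [← ENNReal.ofReal_toReal hVtop, ← ENNReal.ofReal_mul (by positivity)]
    refine ENNReal.ofReal_le_ofReal ?_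
    rw [mul_comm]
    rw [ENNReal.toReal_ofReal ENNReal.toReal_nonneg]
    have : 0 ≤ M / δ ^ (m - 1) := by positivity
    gcongr
    linarith
  · refine (measure_mono inter_subset_left).trans ?_
    rw [← ENNReal.ofReal_toReal hfin, ← hM]
    refine ENNReal.ofReal_le_ofReal ?_
    calc M = M / δ ^ (m - 1) * δ ^ (m - 1) := by field_simp
      _ ≤ M / δ ^ (m - 1) * ρ ^ (m - 1) := by gcongr
      _ ≤ _ := by
          have : 0 ≤ V.toReal := ENNReal.toReal_nonneg
          gcongr
          linarith

/-! ### Singular integrals by dyadic shells -/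

theorem lintegral_le_tsum_of_subset_iUnion {X : Type*} [MeasurableSpace X] {μ : Measure X}
    {f : X → ENNReal} {A : ℕ → Set X}
    {c M : ℕ → ENNReal} {S : Set X} (hA : S ⊆ ⋃ k, A k) (hAm : ∀ k, MeasurableSet (A k))
    (hf : ∀ k, ∀ ξ ∈ A k, f ξ ≤ c k) (hM : ∀ k, μ (A k) ≤ M k) :
    ∫⁻ ξ in S, f ξ ∂μ ≤ ∑' k, c k * M k := by
  refine (lintegral_mono_set hA).trans ((lintegral_iUnion_le _ _).trans
    (ENNReal.tsum_le_tsum fun k => ?_))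
  refine (setLIntegral_mono' (hAm k) (hf k)).trans ?_
  rw [setLIntegral_const]
  gcongr
  exact hM k

section
variable {X : Type*} [PseudoMetricSpace X] [MeasurableSpace X] [BorelSpace X]

/-- On the shell 2^(-k-1) < dist ≤ 2^(-k) the integrand times the measure is of order 2^(-βk), a
convergent geometric series. -/
theorem lintegral_dist_rpow_le {μ : Measure X} {C β : ℝ} {d : ℕ} (hC : 0 < C) (hβ : 0 < β)
    (hβd : β ≤ d) (y : X)
    (hμ : ∀ ρ : ℝ, 0 < ρ → μ (Metric.closedBall y ρ) ≤ ENNReal.ofReal (C * ρ ^ d)) :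
    ∫⁻ ξ in Metric.closedBall y 1 \ {ξ | dist ξ y = 0}, ENNReal.ofReal (dist ξ y ^ (β - d)) ∂μ ≤
      ENNReal.ofReal (2 ^ (d - β) * C * (1 - (1 / 2 : ℝ) ^ β)⁻¹) := by
  have hq0 : (0 : ℝ) < (1 / 2) ^ β := by positivity
  have hq1 : (1 / 2 : ℝ) ^ β < 1 := Real.rpow_lt_one (by norm_num) (by norm_num) hβ
  have h := lintegral_le_tsum_of_subset_iUnion (μ := μ)
    (f := fun ξ => ENNReal.ofReal (dist ξ y ^ (β - d)))
    (S := Metric.closedBall y 1 \ {ξ | dist ξ y = 0})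
    (A := fun k => Metric.closedBall y ((1 / 2) ^ k) ∩ {ξ | (1 / 2) ^ (k + 1) < dist ξ y})
    (c := fun k => ENNReal.ofReal (((1 / 2) ^ (k + 1)) ^ (β - d)))
    (M := fun k => ENNReal.ofReal (C * ((1 / 2) ^ k) ^ d)) ?_ ?_ ?_ ?_
  · refine h.trans (le_of_eq ?_)
    have e : ∀ k : ℕ, ENNReal.ofReal (((1 / 2) ^ (k + 1)) ^ (β - d)) *
        ENNReal.ofReal (C * ((1 / 2) ^ k) ^ d) =
        ENNReal.ofReal (2 ^ (d - β) * C * ((1 / 2 : ℝ) ^ β) ^ k) := fun k => by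
      rw [← ENNReal.ofReal_mul (by positivity)]
      congr 1
      have h2 : ((1 / 2 : ℝ) ^ (k + 1)) ^ (β - d) = 2 ^ (d - β) * ((1 / 2 : ℝ) ^ k) ^ (β - d) := by
        rw [pow_succ, Real.mul_rpow (by positivity) (by norm_num), mul_comm, one_div,
          Real.inv_rpow (by norm_num), ← Real.rpow_neg (by norm_num), neg_sub]
      have h3 : ((1 / 2 : ℝ) ^ k) ^ (β - d) * ((1 / 2 : ℝ) ^ k) ^ d = ((1 / 2 : ℝ) ^ β) ^ k := by
        rw [← Real.rpow_natCast _ d, ← Real.rpow_add (by positivity), sub_add_cancel,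
          ← Real.rpow_natCast, ← Real.rpow_mul (by norm_num), ← Real.rpow_natCast,
          ← Real.rpow_mul (by norm_num), mul_comm]
      rw [h2, ← h3]; ring
    rw [tsum_congr e, ← ENNReal.ofReal_tsum_of_nonneg (fun k => by positivity)
      ((summable_geometric_of_lt_one hq0.le hq1).mul_left _), tsum_mul_left,
      tsum_geometric_of_lt_one hq0.le hq1]
  · rintro ξ ⟨h1, h2⟩
    have h3 : 0 < dist ξ y := lt_of_le_of_ne dist_nonneg (Ne.symm h2)
    obtain ⟨k, hk1, hk2⟩ := exists_nat_pow_near_of_lt_one h3 (Metric.mem_closedBall.1 h1)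
      (show (0 : ℝ) < 1 / 2 by norm_num) (by norm_num)
    exact mem_iUnion.2 ⟨k, hk2, hk1⟩
  · exact fun k => Metric.isClosed_closedBall.measurableSet.inter
      (isOpen_lt continuous_const (by fun_prop)).measurableSet
  · rintro k ξ ⟨-, h1⟩
    refine ENNReal.ofReal_le_ofReal ?_
    exact Real.rpow_le_rpow_of_nonpos (by positivity) (le_of_lt h1) (by linarith)
  · exact fun k => (measure_mono inter_subset_left).trans (hμ _ (by positivity))

/-- Shells of radius δ2^k contribute order 2^(-k) each. The powers of δ cancel, so the bound is
uniform as x approaches the surface. -/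
theorem lintegral_mul_dist_rpow_le {μ : Measure X} {C δ : ℝ} {d : ℕ} (hC : 0 < C) (hδ : 0 < δ)
    (y : X) (hμ : ∀ ρ : ℝ, 0 < ρ → μ (Metric.closedBall y ρ) ≤ ENNReal.ofReal (C * ρ ^ d)) :
    ∫⁻ ξ in {ξ | δ ≤ dist ξ y}, ENNReal.ofReal (δ * dist ξ y ^ (-((d : ℝ) + 1))) ∂μ ≤
      ENNReal.ofReal (2 ^ d * C * 2) := by
  have h := lintegral_le_tsum_of_subset_iUnion (μ := μ)
    (f := fun ξ => ENNReal.ofReal (δ * dist ξ y ^ (-((d : ℝ) + 1))))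
    (S := {ξ | δ ≤ dist ξ y})
    (A := fun k => Metric.closedBall y (δ * 2 ^ (k + 1)) ∩ {ξ | δ * 2 ^ k ≤ dist ξ y})
    (c := fun k => ENNReal.ofReal (δ * (δ * 2 ^ k) ^ (-((d : ℝ) + 1))))
    (M := fun k => ENNReal.ofReal (C * (δ * 2 ^ (k + 1)) ^ d)) ?_ ?_ ?_ ?_
  · refine h.trans (le_of_eq ?_)
    have e : ∀ k : ℕ, ENNReal.ofReal (δ * (δ * 2 ^ k) ^ (-((d : ℝ) + 1))) *
        ENNReal.ofReal (C * (δ * 2 ^ (k + 1)) ^ d) =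
        ENNReal.ofReal (2 ^ d * C * (1 / 2 : ℝ) ^ k) := fun k => by
      rw [← ENNReal.ofReal_mul (by positivity)]
      congr 1
      have h2 : (δ * 2 ^ k : ℝ) ^ (-((d : ℝ) + 1)) = ((δ * 2 ^ k) ^ (d + 1))⁻¹ := by
        rw [Real.rpow_neg (by positivity), ← Real.rpow_natCast _ (d + 1), Nat.cast_add, Nat.cast_one]
      rw [h2, pow_succ 2 k, pow_succ _ d, one_div, inv_pow]
      simp only [mul_pow]
      field_simp
    rw [tsum_congr e, ← ENNReal.ofReal_tsum_of_nonneg (fun k => by positivity)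
      (summable_geometric_two.mul_left _), tsum_mul_left, tsum_geometric_two]
  · intro ξ (h1 : δ ≤ dist ξ y)
    obtain ⟨k, hk1, hk2⟩ := exists_nat_pow_near ((one_le_div hδ).2 h1) (one_lt_two (α := ℝ))
    rw [le_div_iff₀ hδ, mul_comm] at hk1
    rw [div_lt_iff₀ hδ, mul_comm] at hk2
    exact mem_iUnion.2 ⟨k, hk2.le, hk1⟩
  · exact fun k => Metric.isClosed_closedBall.measurableSet.inter
      (isClosed_le continuous_const (by fun_prop)).measurableSet
  · rintro k ξ ⟨-, h1⟩
    refine ENNReal.ofReal_le_ofReal ?_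
    have : (dist ξ y) ^ (-((d : ℝ) + 1)) ≤ (δ * 2 ^ k) ^ (-((d : ℝ) + 1)) :=
      Real.rpow_le_rpow_of_nonpos (by positivity) h1 (by linarith [Nat.cast_nonneg (α := ℝ) d])
    gcongr
  · exact fun k => (measure_mono inter_subset_left).trans (hμ _ (by positivity))
end

theorem measure_singleton_eq_zero_of_closedBall_le {X : Type*} [PseudoMetricSpace X]
    [MeasurableSpace X] {μ : Measure X} {C : ℝ} {d : ℕ} (hd : d ≠ 0) (y : X)
    (hμ : ∀ ρ : ℝ, 0 < ρ → μ (Metric.closedBall y ρ) ≤ ENNReal.ofReal (C * ρ ^ d)) :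
    μ {y} = 0 := by
  have hlim : Tendsto (fun ρ : ℝ => ENNReal.ofReal (C * ρ ^ d)) (𝓝[>] 0) (𝓝 0) := by
    have hc : Continuous fun ρ : ℝ => ENNReal.ofReal (C * ρ ^ d) :=
      ENNReal.continuous_ofReal.comp (by fun_prop)
    have := (hc.tendsto 0).mono_left (nhdsWithin_le_nhds (s := Ioi 0))
    simpa [hd] using this
  refine le_antisymm (ge_of_tendsto hlim ?_) zero_le
  filter_upwards [self_mem_nhdsWithin] with ρ hρ
  refine (measure_mono ?_).trans (hμ ρ hρ)
  exact singleton_subset_iff.2 (Metric.mem_closedBall_self (le_of_lt hρ))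

theorem lintegral_dist_rpow_le_add {X : Type*} [PseudoMetricSpace X] [MeasurableSpace X]
    [BorelSpace X] {μ : Measure X} {C β : ℝ} {d : ℕ} (hC : 0 < C) (hβ : 0 < β) (hβd : β < d)
    (y : X) (hμ : ∀ ρ : ℝ, 0 < ρ → μ (Metric.closedBall y ρ) ≤ ENNReal.ofReal (C * ρ ^ d)) :
    ∫⁻ ξ, ENNReal.ofReal (dist ξ y ^ (β - d)) ∂μ ≤
      ENNReal.ofReal (2 ^ (d - β) * C * (1 - (1 / 2 : ℝ) ^ β)⁻¹) + μ univ := by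
  set f : X → ENNReal := fun ξ => ENNReal.ofReal (dist ξ y ^ (β - d)) with hf
  set A : Set X := Metric.closedBall y 1 \ {ξ | dist ξ y = 0} with hA
  have hAm : MeasurableSet A := Metric.isClosed_closedBall.measurableSet.diff
    (isClosed_eq (by fun_prop) continuous_const).measurableSet
  rw [← lintegral_add_compl f hAm]
  refine add_le_add (lintegral_dist_rpow_le hC hβ hβd.le y hμ) ?_
  have h1 : ∀ ξ ∈ Aᶜ, f ξ ≤ 1 := fun ξ hξ => by
    rw [hf, ← ENNReal.ofReal_one]
    refine ENNReal.ofReal_le_ofReal ?_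
    rcases eq_or_ne (dist ξ y) 0 with h0 | h0
    -- At distance zero the real power with nonzero exponent takes the default value 0, so the point
    -- itself does no harm.
    · rw [h0, Real.zero_rpow (by linarith)]; exact zero_le_one
    · refine Real.rpow_le_one_of_one_le_of_nonpos ?_ (by linarith)
      by_contra! hlt
      exact hξ ⟨Metric.mem_closedBall.2 hlt.le, h0⟩
  refine (setLIntegral_mono' hAm.compl h1).trans ?_
  rw [setLIntegral_const, one_mul]
  exact measure_mono (subset_univ _)

/-! ### Domination on the surface and conclusion -/

theorem aestronglyMeasurable_normalDeriv {m : ℕ} {μ : Measure (EuclideanSpace ℝ (Fin m))}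
    {f : EuclideanSpace ℝ (Fin m) → ℝ} {n : EuclideanSpace ℝ (Fin m) → EuclideanSpace ℝ (Fin m)}
    (hn : AEStronglyMeasurable n μ) :
    AEStronglyMeasurable (fun ξ => normalDeriv f (n ξ) ξ) μ := by
  have h := (measurable_fderiv ℝ f).aestronglyMeasurable (μ := μ)
  exact isBoundedBilinearMap_apply.continuous.comp_aestronglyMeasurable (h.prodMk hn)

/-- The weighted kernel on the surface is dominated by two standard singular kernels. -/
theorem exists_rpow_mul_abs_normalDeriv_qOne_le {m : ℕ} [NeZero m] (hm : 2 < m) {α a β M : ℝ}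
    (hα : 0 < α) (hα1 : α < 1) (ha : 0 < a) (hβ : 0 < β) (hβ1 : β ≤ 1) (hM : 0 < M)
    {Γ : Set (EuclideanSpace ℝ (Fin m))} {n : EuclideanSpace ℝ (Fin m) → EuclideanSpace ℝ (Fin m)}
    (hpos : ∀ ξ ∈ Γ, 0 < ξ 0) (hn : ∀ ξ ∈ Γ, ‖n ξ‖ = 1)
    (hL : ∀ ξ ∈ Γ, ∀ η ∈ Γ, |⟪η - ξ, n ξ⟫| ≤ a * dist η ξ ^ β * dist η ξ)
    (hn0 : ∀ ξ ∈ Γ, |n ξ 0| ≤ M * ξ 0 ^ β) :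
    ∃ K₁ K₂ : ℝ, 0 < K₁ ∧ 0 < K₂ ∧ ∀ x x' : EuclideanSpace ℝ (Fin m), 0 ≤ x 0 →
      x' ∈ closure Γ → (∀ ξ ∈ Γ, dist x x' ≤ dist ξ x) → ∀ ξ ∈ Γ, ξ ≠ x →
      ξ 0 ^ (2 * α) * |normalDeriv (fun η => qOne α η x) (n ξ) ξ| ≤
        K₁ * dist ξ x ^ (β - ((m - 1 : ℕ) : ℝ)) +
          K₂ * (dist x x' * dist ξ x ^ (-(((m - 1 : ℕ) : ℝ) + 1))) := by
  obtain ⟨K, hK, hker⟩ := exists_normalDeriv_qOne_le hm hα hα1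
  refine ⟨K * (a * 2 ^ β * 2 + M), K, by positivity, hK, fun x x' hx hx' hmin ξ hξ hne => ?_⟩
  have hcast : ((m - 1 : ℕ) : ℝ) = (m : ℝ) - 1 := by rw [Nat.cast_sub (by omega)]; simp
  rw [hcast]
  have hξ0 := hpos ξ hξ
  -- The nearest point x' may be an edge point in the hyperplane, with no normal of its own. The
  -- inequality uses only the normal at ξ and extends to the closure by continuity.
  have hLcl : |⟪x' - ξ, n ξ⟫| ≤ a * dist x' ξ ^ β * dist x' ξ := by
    have hcl : IsClosed {y : EuclideanSpace ℝ (Fin m) |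
        |⟪y - ξ, n ξ⟫| ≤ a * dist y ξ ^ β * dist y ξ} := by
      refine isClosed_le (by fun_prop) ?_
      have : Continuous fun y : EuclideanSpace ℝ (Fin m) => dist y ξ ^ β :=
        Continuous.rpow_const (by fun_prop) fun _ => Or.inr hβ.le
      fun_prop
    exact closure_minimal (fun η hη => hL ξ hξ η hη) hcl hx'
  refine (hker ξ x (n ξ) hx hξ0 hne).trans ?_
  rw [← dist_eq_norm]
  set r := dist ξ x with hr
  set δ := dist x x' with hδ
  have hr0 : 0 < r := dist_pos.2 hne
  have hδr : δ ≤ r := hmin ξ hξ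
  have hdx : dist x' ξ ≤ 2 * r := by
    have := dist_triangle ξ x x'
    rw [dist_comm]
    linarith
  have h1 : |⟪ξ - x, n ξ⟫| ≤ a * 2 ^ β * 2 * (r ^ β * r) + δ := by
    have e : ⟪ξ - x, n ξ⟫ = -⟪x' - ξ, n ξ⟫ + ⟪x' - x, n ξ⟫ := by
      rw [← inner_neg_left, ← inner_add_left]; congr 1; abel
    have h2 := abs_real_inner_le_norm (x' - x) (n ξ)
    rw [hn ξ hξ, mul_one, ← dist_eq_norm, dist_comm] at h2
    have h3 : a * dist x' ξ ^ β * dist x' ξ ≤ a * (2 * r) ^ β * (2 * r) := by gcongr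
    rw [Real.mul_rpow (by norm_num) hr0.le] at h3
    rw [e]
    refine (abs_add_le _ _).trans ?_
    rw [abs_neg]
    nlinarith
  set s := √(r ^ 2 + 4 * x 0 * ξ 0) with hs
  have hs2 : s ^ 2 = r ^ 2 + 4 * x 0 * ξ 0 := Real.sq_sqrt (by positivity)
  have hs0 : 0 < s := Real.sqrt_pos.2 (by positivity)
  have hrs : r ≤ s := Real.le_sqrt_of_sq_le (by have : 0 ≤ 4 * x 0 * ξ 0 := by positivity
                                                linarith)
  have hξs : ξ 0 ≤ s := by
    have h3 := sq_add_le_norm_sub_sq_add ξ x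
    rw [← dist_eq_norm, ← hr, ← hs2] at h3
    have := le_of_sq_le_sq h3 hs0.le
    linarith
  -- The rate at which n₁ vanishes pays for 1/s; monotonicity of the power s^(β-1) uses β ≤ 1.
  have h4 : ξ 0 ^ β / s ≤ r ^ (β - 1) := by
    calc ξ 0 ^ β / s ≤ s ^ β / s := by gcongr
      _ = s ^ (β - 1) := by rw [Real.rpow_sub_one hs0.ne']
      _ ≤ r ^ (β - 1) := Real.rpow_le_rpow_of_nonpos hr0 hrs (by linarith)
  have e1 : r ^ β * r * r ^ (-(m : ℝ)) = r ^ (β - ((m : ℝ) - 1)) := by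
    rw [← Real.rpow_add_one hr0.ne', ← Real.rpow_add hr0]; ring_nf
  have e2 : r ^ (β - 1) * r ^ (2 - (m : ℝ)) = r ^ (β - ((m : ℝ) - 1)) := by
    rw [← Real.rpow_add hr0]; ring_nf
  have e3 : -((m : ℝ) - 1 + 1) = -(m : ℝ) := by ring
  rw [e3]
  have h5 : |n ξ 0| * (r ^ (2 - (m : ℝ)) / s) ≤ M * r ^ (β - ((m : ℝ) - 1)) := by
    calc _ ≤ M * ξ 0 ^ β * (r ^ (2 - (m : ℝ)) / s) := by gcongr; exact hn0 ξ hξ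
      _ = M * (ξ 0 ^ β / s * r ^ (2 - (m : ℝ))) := by ring
      _ ≤ M * (r ^ (β - 1) * r ^ (2 - (m : ℝ))) := by gcongr
      _ = _ := by rw [e2]
  have h6 : |⟪ξ - x, n ξ⟫| * r ^ (-(m : ℝ)) ≤
      a * 2 ^ β * 2 * r ^ (β - ((m : ℝ) - 1)) + δ * r ^ (-(m : ℝ)) := by
    calc _ ≤ (a * 2 ^ β * 2 * (r ^ β * r) + δ) * r ^ (-(m : ℝ)) := by gcongr
      _ = a * 2 ^ β * 2 * (r ^ β * r * r ^ (-(m : ℝ))) + δ * r ^ (-(m : ℝ)) := by ring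
      _ = _ := by rw [e1]
  have h7 := mul_le_mul_of_nonneg_left (add_le_add h6 h5) hK.le
  linarith

theorem theorem2 {m : ℕ} [NeZero m] (hm : 2 < m) {α : ℝ} (hα0 : 0 < 2 * α) (hα1 : 2 * α < 1)
    {Ω Γ₁ Γ : Set (EuclideanSpace ℝ (Fin m))} (hΩ : IsDomainBoundedBy Ω Γ₁ Γ)
    {n : EuclideanSpace ℝ (Fin m) → EuclideanSpace ℝ (Fin m)} (hΓ : IsLyapunovSurface Ω Γ n) :
    ∃ C : ℝ, ∀ x : EuclideanSpace ℝ (Fin m), 0 ≤ x 0 →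
      IntegrableOn (fun ξ => ξ 0 ^ (2 * α) * |normalDeriv (fun η => qOne α η x) (n ξ) ξ|)
        Γ (Measure.euclideanHausdorffMeasure (m - 1)) ∧
      ∫ ξ in Γ, ξ 0 ^ (2 * α) * |normalDeriv (fun η => qOne α η x) (n ξ) ξ|
        ∂(Measure.euclideanHausdorffMeasure (m - 1)) ≤ C := by
  -- A nearest point exists only for nonempty Γ.
  rcases Γ.eq_empty_or_nonempty with rfl | hne
  · exact ⟨0, fun x _ => by simp⟩
  obtain ⟨a, β, ha, hβ, hβ1, hH⟩ := hΓ.exists_norm_sub_le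
  have hn1 : ∀ ξ ∈ Γ, ‖n ξ‖ = 1 := fun ξ hξ => (hΓ.normal ξ hξ).1
  have hL : ∀ ξ ∈ Γ, ∀ η ∈ Γ, |⟪η - ξ, n ξ⟫| ≤ a * dist η ξ ^ β * dist η ξ := fun ξ hξ η hη =>
    abs_inner_sub_normal_le hΩ hΓ.normal ha.le hβ hH hξ hη
  obtain ⟨M, hM, hn0⟩ := hΓ.exists_abs_normal_zero_le hΩ ha hβ hH
  have hbdd := hΩ.isBounded_surface
  have hmeas := hΩ.measurableSet_surface
  obtain ⟨C, hC, hreg⟩ := exists_euclideanHausdorffMeasure_inter_closedBall_le hbdd hn1 ha hβ hH hL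
  obtain ⟨K₁, K₂, hK₁, hK₂, hker⟩ := exists_rpow_mul_abs_normalDeriv_qOne_le hm (α := α)
    (by linarith) (by linarith) ha hβ hβ1 hM hΩ.surface_pos hn1 hL hn0
  set μ := (Measure.euclideanHausdorffMeasure (m - 1) :
    Measure (EuclideanSpace ℝ (Fin m))).restrict Γ with hμ
  have hμb : ∀ (y : EuclideanSpace ℝ (Fin m)) (ρ : ℝ), 0 < ρ →
      μ (Metric.closedBall y ρ) ≤ ENNReal.ofReal (C * ρ ^ (m - 1)) := fun y ρ hρ => by
    rw [hμ, Measure.restrict_apply Metric.isClosed_closedBall.measurableSet, inter_comm]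
    exact hreg y ρ hρ
  have hμtop : μ univ ≠ ⊤ := by
    obtain ⟨ρ, hρ⟩ := (Metric.isBounded_iff_subset_closedBall 0).1 hbdd
    have h1 : Γ ⊆ Γ ∩ Metric.closedBall 0 (max ρ 1) := fun ξ hξ =>
      ⟨hξ, Metric.closedBall_subset_closedBall (le_max_left _ _) (hρ hξ)⟩
    rw [hμ, Measure.restrict_apply_univ]
    exact ((measure_mono h1).trans_lt ((hreg 0 _ (by positivity)).trans_lt
      ENNReal.ofReal_lt_top)).ne
  have hm1 : m - 1 ≠ 0 := by omega
  have hβd : β < ((m - 1 : ℕ) : ℝ) := by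
    have : ((2 : ℕ) : ℝ) ≤ ((m - 1 : ℕ) : ℝ) := by exact_mod_cast (by omega : 2 ≤ m - 1)
    push_cast at this
    linarith
  set B : ENNReal := ENNReal.ofReal K₁ * (ENNReal.ofReal (2 ^ (((m - 1 : ℕ) : ℝ) - β) * C *
    (1 - (1 / 2 : ℝ) ^ β)⁻¹) + μ univ) + ENNReal.ofReal K₂ *
    ENNReal.ofReal (2 ^ (m - 1) * C * 2) with hB
  have hBtop : B ≠ ⊤ := ENNReal.add_ne_top.2
    ⟨ENNReal.mul_ne_top ENNReal.ofReal_ne_top (ENNReal.add_ne_top.2 ⟨ENNReal.ofReal_ne_top, hμtop⟩),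
      ENNReal.mul_ne_top ENNReal.ofReal_ne_top ENNReal.ofReal_ne_top⟩
  have hncont : ContinuousOn n Γ := by
    intro x hx
    rw [ContinuousWithinAt, tendsto_iff_norm_sub_tendsto_zero]
    have hlim : Tendsto (fun ξ => a * dist ξ x ^ β) (𝓝[Γ] x) (𝓝 0) := by
      have hc : Continuous fun ξ => a * dist ξ x ^ β :=
        continuous_const.mul (Continuous.rpow_const (by fun_prop) fun _ => Or.inr hβ.le)
      have := (hc.tendsto x).mono_left (nhdsWithin_le_nhds (s := Γ))
      simpa [Real.zero_rpow hβ.ne'] using this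
    refine squeeze_zero' (Eventually.of_forall fun _ => norm_nonneg _) ?_ hlim
    filter_upwards [self_mem_nhdsWithin] with ξ hξ
    exact hH ξ hξ x hx
  refine ⟨B.toReal, fun x hx => ?_⟩
  obtain ⟨x', hx', hmin⟩ := hbdd.isCompact_closure.exists_infDist_eq_dist hne.closure x
  have hmin' : ∀ ξ ∈ Γ, dist x x' ≤ dist ξ x := fun ξ hξ => by
    rw [← hmin, dist_comm]
    exact Metric.infDist_le_dist_of_mem (subset_closure hξ)
  set f : EuclideanSpace ℝ (Fin m) → ℝ := fun ξ =>
    ξ 0 ^ (2 * α) * |normalDeriv (fun η => qOne α η x) (n ξ) ξ| with hf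
  have hfm : AEStronglyMeasurable f μ := by
    refine AEStronglyMeasurable.mul ?_ ?_
    · exact (continuous_apply_zero.measurable.pow_const _).aestronglyMeasurable
    · exact (aestronglyMeasurable_normalDeriv
        (hncont.aestronglyMeasurable hmeas)).norm
  have hf0 : 0 ≤ᵐ[μ] f := (ae_restrict_mem hmeas).mono fun ξ hξ =>
    mul_nonneg (Real.rpow_nonneg (hΩ.surface_pos ξ hξ).le _) (abs_nonneg _)
  have hne' : ∀ᵐ ξ ∂μ, ξ ≠ x := by
    rw [ae_iff]
    simpa using measure_singleton_eq_zero_of_closedBall_le hm1 x (hμb x)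
  have hI₂ : ∫⁻ ξ, ENNReal.ofReal (dist x x' * dist ξ x ^ (-(((m - 1 : ℕ) : ℝ) + 1))) ∂μ ≤
      ENNReal.ofReal (2 ^ (m - 1) * C * 2) := by
    -- If x lies in the closure of Γ, the factor δ = 0 kills the integrand; otherwise all of Γ lies
    -- at distance at least δ from x.
    rcases eq_or_lt_of_le (dist_nonneg (x := x) (y := x')) with h0 | h0
    · simp [← h0]
    · refine le_trans (le_of_eq ?_) (lintegral_mul_dist_rpow_le hC h0 x (hμb x))
      rw [Measure.restrict_eq_self_of_ae_mem]
      exact (ae_restrict_mem hmeas).mono hmin'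
  have hI₁ := lintegral_dist_rpow_le_add hC hβ hβd x (hμb x)
  have hbound : ∫⁻ ξ, ENNReal.ofReal (f ξ) ∂μ ≤ B := by
    have hm₁ : Measurable fun ξ : EuclideanSpace ℝ (Fin m) =>
        ENNReal.ofReal (dist ξ x ^ (β - ((m - 1 : ℕ) : ℝ))) := by fun_prop
    have hm₂ : Measurable fun ξ : EuclideanSpace ℝ (Fin m) =>
        ENNReal.ofReal (dist x x' * dist ξ x ^ (-(((m - 1 : ℕ) : ℝ) + 1))) := by fun_prop
    calc ∫⁻ ξ, ENNReal.ofReal (f ξ) ∂μ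
        ≤ ∫⁻ ξ, (ENNReal.ofReal K₁ * ENNReal.ofReal (dist ξ x ^ (β - ((m - 1 : ℕ) : ℝ))) +
            ENNReal.ofReal K₂ *
              ENNReal.ofReal (dist x x' * dist ξ x ^ (-(((m - 1 : ℕ) : ℝ) + 1)))) ∂μ := by
          refine lintegral_mono_ae ?_
          filter_upwards [ae_restrict_mem hmeas, hne'] with ξ hξ hξx
          rw [← ENNReal.ofReal_mul hK₁.le, ← ENNReal.ofReal_mul hK₂.le,
            ← ENNReal.ofReal_add (by positivity) (by positivity)]
          exact ENNReal.ofReal_le_ofReal (hker x x' hx hx' hmin' ξ hξ hξx)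
      _ = ENNReal.ofReal K₁ * ∫⁻ ξ, ENNReal.ofReal (dist ξ x ^ (β - ((m - 1 : ℕ) : ℝ))) ∂μ +
          ENNReal.ofReal K₂ * ∫⁻ ξ,
            ENNReal.ofReal (dist x x' * dist ξ x ^ (-(((m - 1 : ℕ) : ℝ) + 1))) ∂μ := by
          rw [lintegral_add_left (hm₁.const_mul _), lintegral_const_mul _ hm₁,
            lintegral_const_mul _ hm₂]
      _ ≤ B := by
          rw [hB]
          gcongr
  refine ⟨⟨hfm, ?_⟩, ?_⟩
  · rw [hasFiniteIntegral_iff_ofReal hf0]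
    exact hbound.trans_lt hBtop.lt_top
  · change ∫ ξ, f ξ ∂μ ≤ _
    rw [integral_eq_lintegral_of_nonneg_ae hf0 hfm]
    exact ENNReal.toReal_mono hBtop hbound
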